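/- Let $k\ge 1$ be fixed. A rational $k$-level LP instance $(A,b,c)$ consists of numbers $n_l\ge 1$, $m_l\ge 0$ and data $A_{li}\in\mathbb{Q}^{m_l\times n_i}$, $b_l\in\mathbb{Q}^{m_l}$ ($1\le l,i\le k$), $c_{li}\in\mathbb{Q}^{n_i}$ ($1\le l\le i\le k$). Given $x_1,\dots,x_{l-1}$, the problem of player $l$ is $$\inf_{x_l,\dots,x_k}\Big\{\sum_{i=l}^k c_{li}^\top x_i \;:\; \sum_{i=1}^k A_{li}x_i\ge b_l,\ (x_{l+1},\dots,x_k)\in\mathcal S_{l+1}(x_1,\dots,x_l)\Big\},$$ where $\mathcal S_{l+1}(x_1,\dots,x_l)$ is the set of optimal solutions of the problem of player $l+1$ given $x_1,\dots,x_l$, and this last condition is absent for $l=k$. Feasible solutions, optimal solutions and the optimal objective value (in $[-\infty,\infty]$) of the instance are those of the problem of player $1$. The size of a rational $p/q$ in lowest terms ($q\ge 1$) is $1+\lceil\log_2(|p|+1)\rceil+\lceil\log_2(q+1)\rceil$; the size of a rational vector or matrix is its number of entries plus the sum of their sizes. Let $n=n_1+\dots+n_k$, let $\sigma$ be the maximum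 size of an entry of $A,b,c$, and let $L$, the input size, be the total size of all $A_{li}$, $b_l$ and $c_{li}$. There is a polynomial $p$, depending only on $k$, such that for every rational $k$-level LP instance: 1. The feasible set is a union of finitely many rational generalized polyhedra, that is, sets of the form $\{x\in\mathbb{R}^n : Bx\ge d,\ Cx>e\}$ with rational $B,d,C,e$, where all entries of $B,d,C,e$ have size at most $p(n+\sigma)$ (in particular, polynomial in the input size, since $n+\sigma\le L$). 2. If the instance is feasible, it has a rational feasible solution of size at most $p(L)$. 3. If the instance has an optimal solution, it has a rational optimal solution of size at most $p(L)$. 4. If the optimal objective value is finite (attained or not), it is a rational number of size at most $p(L)$. -/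

import Mathlib

namespace MultilevelLP

/-! ### Encoding sizes -/

/-- Binary encoding size of a rational number `p / q` in lowest terms:
`1 + ⌈log₂ (|p| + 1)⌉ + ⌈log₂ (q + 1)⌉`. -/
def ratSize (r : ℚ) : ℕ :=
  1 + Nat.clog 2 (r.num.natAbs + 1) + Nat.clog 2 (r.den + 1)

/-- Encoding size of a rational vector: its dimension plus the sizes of its entries. -/
def vecSize {ι : Type} [Fintype ι] (v : ι → ℚ) : ℕ :=
  Fintype.card ι + ∑ j, ratSize (v j)

/-- Encoding size of a rational matrix: its number of entries plus their sizes. -/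
def matSize {ι κ : Type} [Fintype ι] [Fintype κ] (M : Matrix ι κ ℚ) : ℕ :=
  Fintype.card ι * Fintype.card κ + ∑ r, ∑ j, ratSize (M r j)

/-! ### Rational generalized polyhedra -/

/-- The set `{x : A x ≥ a, B x > b}` of real vectors, for rational data `A, a, B, b`. -/
def genPolyhedron {ι : Type} [Fintype ι] {m m' : ℕ}
    (A : Matrix (Fin m) ι ℚ) (a : Fin m → ℚ) (B : Matrix (Fin m') ι ℚ) (b : Fin m' → ℚ) :
    Set (ι → ℝ) :=
  {x | (∀ r, (a r : ℝ) ≤ ∑ j, (A r j : ℝ) * x j) ∧ ∀ r, (b r : ℝ) < ∑ j, (B r j : ℝ) * x j}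

/-- `Q` is a rational generalized polyhedron that can be defined by finitely many weak and strict
linear inequalities all of whose coefficients (right-hand sides included) are rationals of size
at most `s`. -/
def IsRatGenPolyhedron {ι : Type} [Fintype ι] (s : ℕ) (Q : Set (ι → ℝ)) : Prop :=
  ∃ (m m' : ℕ) (A : Matrix (Fin m) ι ℚ) (a : Fin m → ℚ)
    (B : Matrix (Fin m') ι ℚ) (b : Fin m' → ℚ),
    (∀ r j, ratSize (A r j) ≤ s) ∧ (∀ r, ratSize (a r) ≤ s) ∧
    (∀ r j, ratSize (B r j) ≤ s) ∧ (∀ r, ratSize (b r) ≤ s) ∧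
    Q = genPolyhedron A a B b

/-! ### Multilevel linear programs -/

/-- Minimizers of the objective `f` over the set `S`. -/
def argmin {α : Type} (f : α → ℝ) (S : Set α) : Set α :=
  {x | x ∈ S ∧ ∀ y ∈ S, f x ≤ f y}

/-- A rational `k`-level LP instance `(A, b, c)`. Players are indexed by `Fin k`; player `l` has
`n l ≥ 1` variables, `m l ≥ 0` linear constraints and the objective `∑_{i ≥ l} c_{li} x_i`.
The vectors `c l i` with `i < l` are never used. -/
structure Instance (k : ℕ) where
  n : Fin k → ℕ
  n_pos : ∀ l, 0 < n l
  m : Fin k → ℕ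
  A : (l i : Fin k) → Matrix (Fin (m l)) (Fin (n i)) ℚ
  b : (l : Fin k) → Fin (m l) → ℚ
  c : (_l i : Fin k) → Fin (n i) → ℚ

namespace Instance

variable {k : ℕ} (P : Instance k)

/-- Index set of all variables: `⟨i, j⟩` is the `j`-th variable of player `i`. -/
abbrev Var : Type := (i : Fin k) × Fin (P.n i)

/-- Total number of variables `n_1 + ⋯ + n_k`. -/
def numVars : ℕ := ∑ i, P.n i

/-- The maximum size `σ` of an entry of `A`, `b` and `c`. -/
def maxEntrySize : ℕ :=
  max (Finset.univ.sup fun l => Finset.univ.sup fun i =>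
        Finset.univ.sup fun r => Finset.univ.sup fun j => ratSize (P.A l i r j))
    (max (Finset.univ.sup fun l => Finset.univ.sup fun r => ratSize (P.b l r))
      (Finset.univ.sup fun l => (Finset.Ici l).sup fun i =>
        Finset.univ.sup fun j => ratSize (P.c l i j)))

/-- The input size: the total encoding size of `A`, `b` and `c`. -/
def inputSize : ℕ :=
  (∑ l, ∑ i, matSize (P.A l i)) + (∑ l, vecSize (P.b l)) +
    ∑ l, ∑ i ∈ Finset.Ici l, vecSize (P.c l i)

/-- Objective of player `l`: `∑_{i ≥ l} c_{li}ᵀ x_i`. -/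
def objective (l : Fin k) (x : P.Var → ℝ) : ℝ :=
  ∑ i ∈ Finset.Ici l, ∑ j, (P.c l i j : ℝ) * x ⟨i, j⟩

/-- The linear constraints of player `l`: `∑_i A_{li} x_i ≥ b_l`. -/
def LinearConstraints (l : Fin k) (x : P.Var → ℝ) : Prop :=
  ∀ r, (P.b l r : ℝ) ≤ ∑ i, ∑ j, (P.A l i r j : ℝ) * x ⟨i, j⟩

/-- Feasible set of the problem of player `l` when the preceding players' decisions
`x_i = z_i`, `i < l`, are given. A solution `(x_l, …, x_k)` is represented by the full vector
`(z_1, …, z_{l-1}, x_l, …, x_k)`. It has to satisfy the linear constraints of player `l`, and, unless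
`l` is the last player, `(x_{l+1}, …, x_k)` has to be optimal for the problem of player `l + 1`
given `(x_1, …, x_l)`. -/
def feasibleSet (l : Fin k) (z : P.Var → ℝ) : Set (P.Var → ℝ) :=
  {x | (∀ i < l, ∀ j, x ⟨i, j⟩ = z ⟨i, j⟩) ∧ P.LinearConstraints l x ∧
    ∀ h : (l : ℕ) + 1 < k,
      x ∈ argmin (P.objective ⟨(l : ℕ) + 1, h⟩) (feasibleSet ⟨(l : ℕ) + 1, h⟩ x)}
termination_by k - (l : ℕ)

/-- Feasible set of the instance, i.e. of the first player's problem (for the first player no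
decision is given, so the argument `0` is immaterial). -/
def feasible [NeZero k] : Set (P.Var → ℝ) := P.feasibleSet 0 0

/-- Set of optimal solutions of the instance. -/
def optimal [NeZero k] : Set (P.Var → ℝ) := argmin (P.objective 0) P.feasible

/-- Optimal objective value of the instance in `[-∞, ∞]`: the infimum of the first player's
objective over the feasible set (`⊤` if infeasible, `⊥` if unbounded). -/
noncomputable def optValue [NeZero k] : EReal :=
  ⨅ x ∈ P.feasible, ((P.objective 0 x : ℝ) : EReal)

end Instance

end MultilevelLP

/-! ### Basic solutions of systems of linear inequalities. -/

namespace MultilevelLP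

open Matrix

/-! The proof is quantifier elimination in back-and-forth form. Two points are `M`-similar if every
affine form with integer coefficients at most `M` has the same sign at both. The heart is
`Sim.exists_extension`: if `x`, `x'` are similar for the larger bound `elimBound q M`, then every
choice of `q` further coordinates `y` at `x` has a counterpart `y'` at `x'` with `(x, y)` and `(x',
y')` `M`-similar.

To find `y'`, consider all sign conditions valid at `(x, y)`, with each strict inequality tightened
by a small `ε`. Some basic solution, given by Cramer's rule as an affine function of `x` and `ε`,
solves this system for arbitrarily small `ε`. Substituting it turns the conditions into
lexicographic sign conditions on forms in `x` with coefficients at most `elimBound q M`. They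
therefore hold at `x'` too, where the same formula defines `y'`.

Consequently, minimizing over the fibers of a union of similarity classes yields a union of slightly
finer classes (`Saturated.argmin_fiber`). Backward induction over the players does this for the
feasible set. One step multiplies the bit length of the bound by a polynomial factor at most (plus a
polynomial term), so for fixed `k` it stays polynomial. The four claims follow: there are finitely
many classes, each a generalized polyhedron; each class contains a small rational point
(`exists_rat_sim`); and a finite infimum of a union of classes on the line is a root of a small form
(`Saturated.isGLB_eq_div`). -/

/-- A nonempty polyhedron has a point whose tight constraints span all constraint normals. -/
theorem exists_tight_span {m κ : Type*} [Finite m] [Fintype κ]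
    (A : Matrix m κ ℝ) (u : m → ℝ) (y : κ → ℝ) (hy : ∀ i, u i ≤ A i ⬝ᵥ y) :
    ∃ z : κ → ℝ, (∀ i, u i ≤ A i ⬝ᵥ z) ∧
      ∀ j, A j ∈ Submodule.span ℝ (A '' {i | A i ⬝ᵥ z = u i}) := by
  classical
  -- Take a feasible point with maximal tight set. A normal outside the span would give a direction
  -- that keeps all tight constraints tight and can be followed until a new one becomes tight.
  obtain ⟨T, hT⟩ := (Set.toFinite {T : Set m | ∃ z : κ → ℝ, (∀ i, u i ≤ A i ⬝ᵥ z) ∧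
    T = {i | A i ⬝ᵥ z = u i}}).exists_maximal ⟨_, y, hy, rfl⟩
  obtain ⟨z, hz, rfl⟩ := hT.1
  refine ⟨z, hz, fun j => ?_⟩
  by_contra hj
  obtain ⟨f, hfj, hf⟩ := Submodule.exists_le_ker_of_notMem hj
  obtain ⟨d, hdj, hd⟩ : ∃ d : κ → ℝ, A j ⬝ᵥ d < 0 ∧ ∀ i, A i ⬝ᵥ z = u i → A i ⬝ᵥ d = 0 := by
    have key : ∀ v, f v = v ⬝ᵥ (fun k => f (Pi.single k 1)) := by
      intro v
      rw [LinearMap.pi_apply_eq_sum_univ f v]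
      simp only [dotProduct, smul_eq_mul]
      refine Finset.sum_congr rfl fun k _ => ?_
      congr 2
      ext l
      simp [Pi.single_apply, eq_comm]
    have hzero : ∀ i, A i ⬝ᵥ z = u i → A i ⬝ᵥ (fun k => f (Pi.single k 1)) = 0 := by
      intro i hi
      rw [← key]
      exact hf (Submodule.subset_span ⟨i, hi, rfl⟩)
    rcases lt_or_gt_of_ne hfj with h | h
    · exact ⟨_, by rwa [← key], hzero⟩
    · refine ⟨-(fun k => f (Pi.single k 1)), ?_, fun i hi => ?_⟩
      · rw [dotProduct_neg, ← key]; linarith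
      · rw [dotProduct_neg, hzero i hi, neg_zero]
  -- Ratio test: `i₀` is the first constraint that blocks the movement along `d`.
  obtain ⟨i₀, hi₀, hmin⟩ := Set.exists_min_image {i | A i ⬝ᵥ d < 0}
    (fun i => (A i ⬝ᵥ z - u i) / (-(A i ⬝ᵥ d))) (Set.toFinite _) ⟨j, hdj⟩
  set t := (A i₀ ⬝ᵥ z - u i₀) / (-(A i₀ ⬝ᵥ d)) with ht
  have ht0 : 0 ≤ t := div_nonneg (by linarith [hz i₀]) (by
    have : A i₀ ⬝ᵥ d < 0 := hi₀
    linarith)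
  have hval : ∀ i, A i ⬝ᵥ (z + t • d) = A i ⬝ᵥ z + t * (A i ⬝ᵥ d) := by
    intro i
    rw [dotProduct_add, dotProduct_smul, smul_eq_mul]
  have hfeas : ∀ i, u i ≤ A i ⬝ᵥ (z + t • d) := by
    intro i
    rw [hval]
    by_cases hi : A i ⬝ᵥ d < 0
    · have h := hmin i hi
      rw [le_div_iff₀ (by linarith)] at h
      linarith
    · have := mul_nonneg ht0 (not_lt.mp hi)
      linarith [hz i]
  have hsub : {i | A i ⬝ᵥ z = u i} ⊆ {i | A i ⬝ᵥ (z + t • d) = u i} := by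
    intro i hi
    have hi' : A i ⬝ᵥ z = u i := hi
    change A i ⬝ᵥ (z + t • d) = u i
    rw [hval, hd i hi', hi']
    simp
  have hmem : i₀ ∈ {i | A i ⬝ᵥ (z + t • d) = u i} := by
    have hne : A i₀ ⬝ᵥ d ≠ 0 := ne_of_lt hi₀
    change A i₀ ⬝ᵥ (z + t • d) = u i₀
    rw [hval, ht]
    field_simp
    ring
  have h := hT.2 ⟨_, hfeas, rfl⟩ hsub hmem
  exact absurd (hd i₀ h) (ne_of_lt hi₀)

/-- A nonempty polyhedron `{y : A y ≥ u}` contains every solution of some nonsingular square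
system formed by tight constraints `A i y = u i` and equations `y j = 0`. -/
theorem exists_basic_solution {m κ : Type*} [Finite m] [Fintype κ] [DecidableEq κ]
    (A : Matrix m κ ℝ) (u : m → ℝ) (y : κ → ℝ) (hy : ∀ i, u i ≤ A i ⬝ᵥ y) :
    ∃ ρ : κ → m ⊕ κ, ((fromRows A 1).submatrix ρ id).det ≠ 0 ∧
      ∀ z : κ → ℝ, (∀ k, (fromRows A 1) (ρ k) ⬝ᵥ z = Sum.elim u 0 (ρ k)) →
        ∀ i, u i ≤ A i ⬝ᵥ z := by
  classical
  obtain ⟨y₀, hy₀, hspan⟩ := exists_tight_span A u y hy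
  set T := {i | A i ⬝ᵥ y₀ = u i}
  obtain ⟨b₀, hb₀T, hb₀span, hb₀⟩ := exists_linearIndependent ℝ (A '' T)
  let E : Set (κ → ℝ) := Set.range fun k => (1 : Matrix κ κ ℝ) k
  have hE : Submodule.span ℝ E = ⊤ := by
    have : E = Set.range (Pi.basisFun ℝ κ) := by
      ext v
      simp only [E, Set.mem_range, Pi.basisFun_apply]
      refine exists_congr fun k => ?_
      rw [show (1 : Matrix κ κ ℝ) k = Pi.single k 1 from by
        ext l; simp [one_apply, Pi.single_apply, eq_comm]]
    rw [this, Module.Basis.span_eq]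
  -- A basis of the span of the tight normals is completed by unit vectors, that is, by equations `y
  -- k = 0`.
  obtain ⟨b, hbsub, hb₀b, hbspan, hb⟩ := exists_linearIndepOn_id_extension
    (s := b₀) (t := b₀ ∪ E) hb₀ Set.subset_union_left
  have hbtop : ⊤ ≤ Submodule.span ℝ (Set.range ((↑) : b → κ → ℝ)) := by
    rw [Subtype.range_coe, ← hE, Submodule.span_le]
    exact Set.subset_union_right.trans hbspan
  let bas := Module.Basis.mk hb hbtop
  have : Fintype b := FiniteDimensional.fintypeBasisIndex bas
  have hcard : Fintype.card κ = Fintype.card b := by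
    rw [← Module.finrank_eq_card_basis bas, Module.finrank_fintype_fun_eq_card]
  let e : κ ≃ b := Fintype.equivOfCardEq hcard
  have hex : ∀ v : b, ∃ r : m ⊕ κ, fromRows A 1 r = (v : κ → ℝ) ∧
      ((v : κ → ℝ) ∈ b₀ → ∃ i ∈ T, r = Sum.inl i) := by
    intro v
    by_cases hv : (v : κ → ℝ) ∈ b₀
    · obtain ⟨i, hi, hiv⟩ := hb₀T hv
      exact ⟨Sum.inl i, hiv, fun _ => ⟨i, hi, rfl⟩⟩
    · rcases hbsub v.2 with h | ⟨k, hk⟩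
      · exact absurd h hv
      · exact ⟨Sum.inr k, hk, fun h => absurd h hv⟩
  choose r hr hrT using hex
  refine ⟨fun k => r (e k), ?_, fun z hz => ?_⟩
  · have hli : LinearIndependent ℝ (fun k => ((e k : b) : κ → ℝ)) := hb.comp e e.injective
    have hrow : ((fromRows A 1).submatrix (fun k => r (e k)) id).row
        = fun k => ((e k : b) : κ → ℝ) := by
      ext k l
      exact congrFun (hr (e k)) l
    rw [← hrow, linearIndependent_rows_iff_isUnit, isUnit_iff_isUnit_det] at hli
    exact hli.ne_zero
  -- A solution `z` may differ from `y₀`, but `z - y₀` is orthogonal to `b₀`, hence to every normal,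
  -- so `z` inherits the feasibility of `y₀`.
  · have hker : ∀ v ∈ b₀, v ⬝ᵥ (z - y₀) = 0 := by
      intro v hv
      obtain ⟨i, hi, hri⟩ := hrT ⟨v, hb₀b hv⟩ hv
      have h := hz (e.symm ⟨v, hb₀b hv⟩)
      have hv' := hr ⟨v, hb₀b hv⟩
      simp only [Equiv.apply_symm_apply] at h
      rw [hv', hri] at h
      rw [hri] at hv'
      have hi' : A i ⬝ᵥ y₀ = u i := hi
      have hv'' : A i = v := hv'
      rw [dotProduct_sub, h, ← hv'', hi']
      simp
    intro i
    have hspan₀ : ∀ a ∈ Submodule.span ℝ b₀, a ⬝ᵥ (z - y₀) = 0 := by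
      intro a ha
      induction ha using Submodule.span_induction with
      | mem v hv => exact hker v hv
      | zero => simp
      | add v w _ _ hv hw => rw [add_dotProduct, hv, hw, add_zero]
      | smul c v _ hv => rw [smul_dotProduct, hv, smul_zero]
    have h0 := hspan₀ (A i) (by rw [hb₀span]; exact hspan i)
    rw [dotProduct_sub] at h0
    linarith [hy₀ i]

end MultilevelLP
-- Parametric basic solutions with an infinitesimal.
namespace MultilevelLP

open Matrix Filter Topology

/-- The affine form with integer coefficients `a` and constant term `β`. -/
def affForm {ι : Type} [Fintype ι] (a : ι → ℤ) (β : ℤ) (x : ι → ℝ) : ℝ :=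
  ∑ i, (a i : ℝ) * x i + β

/-- Cofactors are determinants of the matrix with one row replaced by a unit vector, whose entries
stay within `M` because `1 ≤ M`. -/
theorem abs_adjugate_le {κ : Type} [Fintype κ] [DecidableEq κ] {M : ℕ} (hM : 1 ≤ M)
    (B : Matrix κ κ ℤ) (hB : ∀ k l, |B k l| ≤ M) (k l : κ) :
    |B.adjugate k l| ≤ ((Fintype.card κ).factorial * M ^ Fintype.card κ : ℕ) := by
  rw [adjugate_apply]
  refine (Matrix.det_le (abv := AbsoluteValue.abs) (x := (M : ℤ)) fun i j => ?_).trans ?_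
  · have h1 : (1 : ℤ) ≤ M := by exact_mod_cast hM
    simp only [AbsoluteValue.abs_apply, updateRow_apply, Pi.single_apply]
    split_ifs
    · simpa using h1
    · simp
    · exact hB i j
  · simp

/-- If `g + ε h ≥ 0` for arbitrarily small `ε > 0` then `(g, h)` is lexicographically
nonnegative. -/
theorem lex_nonneg_of_frequently {g h : ℝ} (H : ∃ᶠ ε in 𝓝[>] (0 : ℝ), 0 ≤ g + ε * h) :
    0 < g ∨ g = 0 ∧ 0 ≤ h := by
  rcases lt_trichotomy g 0 with hg | hg | hg
  · exfalso
    apply H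
    have : Tendsto (fun ε : ℝ => g + ε * h) (𝓝[>] 0) (𝓝 (g + 0 * h)) :=
      ((continuous_const.add (continuous_id.mul continuous_const)).tendsto 0).mono_left
        nhdsWithin_le_nhds
    rw [zero_mul, add_zero] at this
    filter_upwards [this.eventually (gt_mem_nhds hg)] with ε hε
    exact not_le.mpr hε
  · right
    obtain ⟨ε, hε, hε0⟩ := (H.and_eventually self_mem_nhdsWithin).exists
    rw [hg, zero_add] at hε
    exact ⟨hg, nonneg_of_mul_nonneg_right hε hε0⟩
  · exact Or.inl hg

theorem eventually_lex_pos {g h : ℝ} (H : 0 < g ∨ g = 0 ∧ 0 < h) :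
    ∀ᶠ ε in 𝓝[>] (0 : ℝ), 0 < g + ε * h := by
  rcases H with hg | ⟨rfl, hh⟩
  · have : Tendsto (fun ε : ℝ => g + ε * h) (𝓝[>] 0) (𝓝 (g + 0 * h)) :=
      ((continuous_const.add (continuous_id.mul continuous_const)).tendsto 0).mono_left
        nhdsWithin_le_nhds
    rw [zero_mul, add_zero] at this
    exact this.eventually (lt_mem_nhds hg)
  · filter_upwards [self_mem_nhdsWithin] with ε hε
    have : 0 < ε * h := mul_pos hε hh
    linarith

theorem sum_mul_affForm {ι κ : Type} [Fintype ι] [Fintype κ] (p : κ → ℤ) (W : κ → ι → ℤ)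
    (W₀ v : κ → ℤ) (x : ι → ℝ) (ε : ℝ) :
    ∑ k, (p k : ℝ) * (affForm (W k) (W₀ k) x + ε * v k) =
      affForm (fun i => ∑ k, p k * W k i) (∑ k, p k * W₀ k) x
        + ε * ((∑ k, p k * v k : ℤ) : ℝ) := by
  simp only [affForm, mul_add, Finset.sum_add_distrib, Finset.mul_sum, Int.cast_sum, Int.cast_mul,
    Finset.sum_mul]
  rw [Finset.sum_comm]
  congr 1
  · congr 1
    exact Finset.sum_congr rfl fun i _ => Finset.sum_congr rfl fun k _ => by ring
  · exact Finset.sum_congr rfl fun k _ => by ring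

theorem affForm_add_smul {ι : Type} [Fintype ι] (D : ℤ) (a a' : ι → ℤ) (β β' : ℤ) (x : ι → ℝ) :
    affForm (fun i => D * a i + a' i) (D * β + β') x = D * affForm a β x + affForm a' β' x := by
  simp only [affForm, Int.cast_add, Int.cast_mul, add_mul, Finset.sum_add_distrib, mul_add,
    Finset.mul_sum, mul_assoc]
  ring

/-- Parametric basic solutions. Given a system of integer affine inequalities in `(x, y)`, some
of them strict, that is solvable in `y`, it is solved by an explicit `y = (W x + W₀ + ε v) / D`
with small integer coefficients and an infinitesimal `ε > 0`. -/
theorem exists_basic_parametrization {m ι κ : Type} [Finite m] [Fintype ι] [Fintype κ] {M : ℕ}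
    (hM : 1 ≤ M) (c : m → ι → ℤ) (a : m → κ → ℤ) (β s : m → ℤ)
    (hc : ∀ r i, |c r i| ≤ M) (ha : ∀ r k, |a r k| ≤ M) (hβ : ∀ r, |β r| ≤ M)
    (hs : ∀ r, |s r| ≤ 1) (x : ι → ℝ) (y : κ → ℝ)
    (hy : ∀ r, 0 ≤ affForm (c r) (β r) x + ∑ k, (a r k : ℝ) * y k)
    (hy' : ∀ r, 0 < s r → 0 < affForm (c r) (β r) x + ∑ k, (a r k : ℝ) * y k) :
    ∃ (D : ℤ) (W : κ → ι → ℤ) (W₀ v : κ → ℤ), 0 < D ∧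
      D ≤ ((Fintype.card κ).factorial * M ^ Fintype.card κ : ℕ) ∧
      (∀ k i, |W k i| ≤
        (Fintype.card κ * ((Fintype.card κ).factorial * M ^ Fintype.card κ * M) : ℕ)) ∧
      (∀ k, |W₀ k| ≤
        (Fintype.card κ * ((Fintype.card κ).factorial * M ^ Fintype.card κ * M) : ℕ)) ∧
      (∀ k, |v k| ≤
        (Fintype.card κ * ((Fintype.card κ).factorial * M ^ Fintype.card κ * M) : ℕ)) ∧
      ∀ r, 0 < affForm (fun i => D * c r i + ∑ k, a r k * W k i) (D * β r + ∑ k, a r k * W₀ k) x ∨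
        affForm (fun i => D * c r i + ∑ k, a r k * W k i) (D * β r + ∑ k, a r k * W₀ k) x = 0 ∧
          D * s r ≤ ∑ k, a r k * v k := by
  classical
  have hM' : (1 : ℤ) ≤ M := by exact_mod_cast hM
  let A : Matrix m κ ℤ := of a
  let AR : Matrix m κ ℝ := of fun r k => (a r k : ℝ)
  -- A strict constraint (`s r = 1`) is tightened to `≥ ε`; the given `y` still satisfies it for
  -- small `ε`.
  let u : ℝ → m → ℝ := fun ε r => ε * s r - affForm (c r) (β r) x
  have hev : ∀ᶠ ε in 𝓝[>] (0 : ℝ), ∀ r, u ε r ≤ AR r ⬝ᵥ y := by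
    rw [eventually_all]
    intro r
    have hval : AR r ⬝ᵥ y = ∑ k, (a r k : ℝ) * y k := rfl
    by_cases hr : 0 < s r
    · have := eventually_lex_pos (g := affForm (c r) (β r) x + ∑ k, (a r k : ℝ) * y k)
        (h := -(s r : ℝ)) (Or.inl (hy' r hr))
      filter_upwards [this] with ε hε
      simp only [u, hval]
      linarith
    · filter_upwards [self_mem_nhdsWithin] with ε hε
      have h1 : (s r : ℝ) ≤ 0 := by exact_mod_cast not_lt.mp hr
      have h2 : ε * s r ≤ 0 := mul_nonpos_of_nonneg_of_nonpos (le_of_lt hε) h1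
      simp only [u, hval]
      linarith [hy r]
  have hev₂ := hev.mono fun ε hε => exists_basic_solution AR (u ε) y hε
  -- Pigeonhole: there are finitely many choices `ρ`, so one of them serves arbitrarily small `ε`.
  obtain ⟨ρ, hρ⟩ : ∃ ρ : κ → m ⊕ κ, ∃ᶠ ε in 𝓝[>] (0 : ℝ),
      ((fromRows AR 1).submatrix ρ id).det ≠ 0 ∧
      ∀ z : κ → ℝ, (∀ k, (fromRows AR 1) (ρ k) ⬝ᵥ z = Sum.elim (u ε) 0 (ρ k)) →
        ∀ i, u ε i ≤ AR i ⬝ᵥ z := by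
    by_contra hcon
    push Not at hcon
    obtain ⟨ε, hε, ρ, hρ⟩ := ((eventually_all.2 hcon).and hev₂).exists
    obtain ⟨z, hz, i, hi⟩ := hε ρ hρ.1
    exact absurd (hρ.2 z hz i) (not_le.mpr hi)
  let B : Matrix κ κ ℤ := (fromRows A 1).submatrix ρ id
  have hrow : ∀ k l, fromRows AR 1 (ρ k) l = (B k l : ℝ) := by
    intro k l
    simp only [B, submatrix_apply, id]
    rcases ρ k with r | j
    · rfl
    · simp [one_apply]
  have hdetR : ((fromRows AR 1).submatrix ρ id).det = (B.det : ℝ) := by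
    rw [show (B.det : ℝ) = (Int.castRingHom ℝ) B.det from rfl, RingHom.map_det]
    congr 1
    ext k l
    exact hrow k l
  have hdet : B.det ≠ 0 := by
    obtain ⟨ε, hε⟩ := hρ.exists
    intro h
    exact hε.1 (by rw [hdetR, h, Int.cast_zero])
  have hB : ∀ k l, |B k l| ≤ M := by
    intro k l
    simp only [B, submatrix_apply, id]
    rcases ρ k with r | j
    · exact ha r l
    · simp only [fromRows_apply_inr, one_apply]
      split_ifs
      · simpa using hM'
      · simp
  set K : ℕ := (Fintype.card κ).factorial * M ^ Fintype.card κ with hK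
  have hadj : ∀ k l, |B.adjugate k l| ≤ (K : ℤ) := fun k l => abs_adjugate_le hM B hB k l
  let ext (t : m → ℤ) (l : κ) : ℤ := Sum.elim t 0 (ρ l)
  -- Cramer's rule: `|det B|` times the solution of `B z = ext t`. The sign makes the common
  -- denominator positive.
  let lift (t : m → ℤ) (k : κ) : ℤ := B.det.sign * ∑ l, B.adjugate k l * ext t l
  have hlift : ∀ t l, ∑ k, B l k * lift t k = |B.det| * ext t l := by
    intro t l
    have h1 : ∑ k, B l k * lift t k = B.det.sign * ((B * B.adjugate) *ᵥ ext t) l := by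
      rw [← mulVec_mulVec]
      simp only [lift, mulVec, dotProduct, Finset.mul_sum]
      exact Finset.sum_congr rfl fun k _ => Finset.sum_congr rfl fun l' _ => by ring
    rw [h1, mul_adjugate, smul_mulVec, one_mulVec, Pi.smul_apply, smul_eq_mul, ← mul_assoc,
      Int.sign_mul_self_eq_abs]
  have hbound : ∀ t : m → ℤ, (∀ r, |t r| ≤ M) → ∀ k,
      |lift t k| ≤ (Fintype.card κ * (K * M) : ℕ) := by
    intro t ht k
    have hext : ∀ l, |ext t l| ≤ M := by
      intro l
      simp only [ext]
      rcases ρ l with r | j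
      · exact ht r
      · simp
    have hsign : |B.det.sign| ≤ 1 := by
      rcases lt_or_gt_of_ne hdet with h | h
      · simp [Int.sign_eq_neg_one_of_neg h]
      · simp [Int.sign_eq_one_of_pos h]
    calc |lift t k| ≤ 1 * |∑ l, B.adjugate k l * ext t l| := by
          rw [abs_mul]; exact mul_le_mul_of_nonneg_right hsign (abs_nonneg _)
      _ ≤ ∑ l, |B.adjugate k l * ext t l| := by
          rw [one_mul]; exact Finset.abs_sum_le_sum_abs _ _
      _ ≤ ∑ _l : κ, (K * M : ℤ) := Finset.sum_le_sum fun l _ => by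
          rw [abs_mul]
          exact mul_le_mul (hadj k l) (hext l) (abs_nonneg _) (by positivity)
      _ = (Fintype.card κ * (K * M) : ℕ) := by simp
  have hDpos : 0 < |B.det| := abs_pos.mpr hdet
  have hDposR : (0 : ℝ) < ((|B.det| : ℤ) : ℝ) := by exact_mod_cast hDpos
  refine ⟨|B.det|, fun k i => lift (fun r => -c r i) k, lift fun r => -β r, lift s, hDpos, ?_,
    fun k i => hbound _ (fun r => by rw [abs_neg]; exact hc r i) k,
    hbound _ (fun r => by rw [abs_neg]; exact hβ r),
    hbound _ (fun r => (hs r).trans hM'), fun r => ?_⟩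
  · have := Matrix.det_le (abv := AbsoluteValue.abs) (A := B) (x := (M : ℤ)) hB
    simpa [hK] using this
  set W : κ → ι → ℤ := fun k i => lift (fun r => -c r i) k with hW
  set W₀ : κ → ℤ := lift fun r => -β r with hW₀
  rw [affForm_add_smul]
  have hfreq : ∃ᶠ ε in 𝓝[>] (0 : ℝ), 0 ≤ (((|B.det| : ℤ) : ℝ) * affForm (c r) (β r) x +
      affForm (fun i => ∑ k, a r k * W k i) (∑ k, a r k * W₀ k) x) +
      ε * ((∑ k, a r k * lift s k : ℤ) - ((|B.det| : ℤ) : ℝ) * s r) := by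
    refine hρ.mono fun ε hε => ?_
    let z : κ → ℝ := fun k => (affForm (W k) (W₀ k) x + ε * lift s k) / ((|B.det| : ℤ) : ℝ)
    have hz : ∀ p : κ → ℤ, ∑ k, (p k : ℝ) * z k =
        (affForm (fun i => ∑ k, p k * W k i) (∑ k, p k * W₀ k) x
        + ε * ((∑ k, p k * lift s k : ℤ) : ℝ)) / ((|B.det| : ℤ) : ℝ) := by
      intro p
      rw [← sum_mul_affForm, Finset.sum_div]
      exact Finset.sum_congr rfl fun k _ => by simp only [z]; ring
    have h := hε.2 z (fun l => ?_) r
    · have h1 : AR r ⬝ᵥ z = ∑ k, (a r k : ℝ) * z k := rfl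
      rw [h1, hz, le_div_iff₀ hDposR] at h
      simp only [u] at h
      linarith
    · have h1 : fromRows AR 1 (ρ l) ⬝ᵥ z = ∑ k, (B l k : ℝ) * z k := by
        simp only [dotProduct, hrow]
      rw [h1, hz, div_eq_iff hDposR.ne']
      have h2 : (fun i => ∑ k, B l k * W k i) = fun i => |B.det| * ext (fun r => -c r i) l := by
        ext i; exact hlift _ l
      rw [h2, hlift, hlift]
      simp only [ext]
      rcases ρ l with r' | j
      · simp only [Sum.elim_inl, affForm, u, Int.cast_mul, Int.cast_neg, mul_neg, neg_mul,
          Finset.sum_neg_distrib, mul_assoc, ← Finset.mul_sum]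
        ring
      · simp [affForm]
  rcases lex_nonneg_of_frequently hfreq with h | ⟨h, h'⟩
  · exact Or.inl h
  · refine Or.inr ⟨h, ?_⟩
    have : ((|B.det| * s r : ℤ) : ℝ) ≤ ((∑ k, a r k * lift s k : ℤ) : ℝ) := by
      push_cast at h' ⊢
      linarith
    exact_mod_cast this

end MultilevelLP
-- Similarity of points and the back-and-forth property.
namespace MultilevelLP

open Filter Topology

/-- Two points are `M`-similar if no affine form with integer coefficients of absolute value at
most `M` has different signs at these points. -/
def Sim {ι : Type} [Fintype ι] (M : ℕ) (x x' : ι → ℝ) : Prop :=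
  ∀ (a : ι → ℤ) (β : ℤ), (∀ i, |a i| ≤ M) → |β| ≤ M → (0 ≤ affForm a β x ↔ 0 ≤ affForm a β x')

theorem affForm_neg {ι : Type} [Fintype ι] (a : ι → ℤ) (β : ℤ) (x : ι → ℝ) :
    affForm (fun i => -a i) (-β) x = -affForm a β x := by
  simp only [affForm, Int.cast_neg, neg_mul, Finset.sum_neg_distrib]
  ring

theorem affForm_sumElim {ι κ : Type} [Fintype ι] [Fintype κ] (a : ι ⊕ κ → ℤ) (β : ℤ)
    (x : ι → ℝ) (y : κ → ℝ) :
    affForm a β (Sum.elim x y) =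
      affForm (fun i => a (Sum.inl i)) β x + ∑ k, (a (Sum.inr k) : ℝ) * y k := by
  simp only [affForm, Fintype.sum_sum_type, Sum.elim_inl, Sum.elim_inr]
  ring

theorem Sim.symm {ι : Type} [Fintype ι] {M : ℕ} {x x' : ι → ℝ} (h : Sim M x x') : Sim M x' x :=
  fun a β ha hβ => (h a β ha hβ).symm

theorem Sim.mono {ι : Type} [Fintype ι] {M N : ℕ} (hMN : M ≤ N) {x x' : ι → ℝ}
    (h : Sim N x x') : Sim M x x' := by
  have hMN' : (M : ℤ) ≤ N := by exact_mod_cast hMN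
  exact fun a β ha hβ => h a β (fun i => (ha i).trans hMN') (hβ.trans hMN')

theorem Sim.nonpos_iff {ι : Type} [Fintype ι] {M : ℕ} {x x' : ι → ℝ} (h : Sim M x x')
    {a : ι → ℤ} {β : ℤ} (ha : ∀ i, |a i| ≤ M) (hβ : |β| ≤ M) :
    affForm a β x ≤ 0 ↔ affForm a β x' ≤ 0 := by
  have := h (fun i => -a i) (-β) (fun i => by rw [abs_neg]; exact ha i) (by rwa [abs_neg])
  rwa [affForm_neg, affForm_neg, neg_nonneg, neg_nonneg] at this

theorem Sim.pos_iff {ι : Type} [Fintype ι] {M : ℕ} {x x' : ι → ℝ} (h : Sim M x x')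
    {a : ι → ℤ} {β : ℤ} (ha : ∀ i, |a i| ≤ M) (hβ : |β| ≤ M) :
    0 < affForm a β x ↔ 0 < affForm a β x' := by
  rw [← not_le, ← not_le, h.nonpos_iff ha hβ]

theorem Sim.eq_zero_iff {ι : Type} [Fintype ι] {M : ℕ} {x x' : ι → ℝ} (h : Sim M x x')
    {a : ι → ℤ} {β : ℤ} (ha : ∀ i, |a i| ≤ M) (hβ : |β| ≤ M) :
    affForm a β x = 0 ↔ affForm a β x' = 0 := by
  rw [le_antisymm_iff, le_antisymm_iff, h.nonpos_iff ha hβ, h a β ha hβ]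

/-- The bounded forms are closed under negation, so preserving positivity and vanishing in one
direction settles all signs. -/
theorem Sim.of_pos_of_zero {ι : Type} [Fintype ι] {M : ℕ} {x x' : ι → ℝ}
    (h : ∀ (a : ι → ℤ) (β : ℤ), (∀ i, |a i| ≤ M) → |β| ≤ M →
      (0 < affForm a β x → 0 < affForm a β x') ∧ (affForm a β x = 0 → affForm a β x' = 0)) :
    Sim M x x' := by
  intro a β ha hβ
  rcases lt_trichotomy (affForm a β x) 0 with hx | hx | hx
  · have := (h (fun i => -a i) (-β) (fun i => by rw [abs_neg]; exact ha i)
      (by rwa [abs_neg])).1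
    rw [affForm_neg, affForm_neg, neg_pos, neg_pos] at this
    exact iff_of_false (not_le.mpr hx) (not_le.mpr (this hx))
  · rw [(h a β ha hβ).2 hx, hx]
  · exact iff_of_true hx.le ((h a β ha hβ).1 hx).le

theorem Sim.inr {ι κ : Type} [Fintype ι] [Fintype κ] {M : ℕ} {x x' : ι → ℝ} {y y' : κ → ℝ}
    (h : Sim M (Sum.elim x y) (Sum.elim x' y')) : Sim M y y' := by
  intro a β ha hβ
  have := h (Sum.elim 0 a) β (by rintro (i | k) <;> simp [ha]) hβ
  simp only [affForm_sumElim, Sum.elim_inl, Sum.elim_inr] at this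
  simpa [affForm, add_comm] using this

/-- The coefficient bound after the elimination of `q` variables from affine forms with
coefficients bounded by `M`. -/
def elimBound (q M : ℕ) : ℕ :=
  q.factorial * M ^ q * M + q * (M * (q * (q.factorial * M ^ q * M)))

theorem le_elimBound (q : ℕ) {M : ℕ} (hM : 1 ≤ M) : M ≤ elimBound q M :=
  (Nat.le_mul_of_pos_left M (Nat.mul_pos q.factorial_pos (pow_pos hM q))).trans
    (Nat.le_add_right _ _)

theorem mul_le_elimBound (q : ℕ) {M : ℕ} (hM : 1 ≤ M) :
    q * (q.factorial * M ^ q * M) ≤ elimBound q M := by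
  refine le_trans ?_ (Nat.le_add_left _ _)
  rcases Nat.eq_zero_or_pos q with rfl | hq
  · simp
  · rw [← mul_assoc]
    exact Nat.le_mul_of_pos_left _ (Nat.mul_pos hq hM) |>.trans (by rw [mul_assoc])

theorem factorial_mul_le_elimBound (q : ℕ) {M : ℕ} (hM : 1 ≤ M) :
    q.factorial * M ^ q ≤ elimBound q M :=
  (Nat.le_mul_of_pos_right _ hM).trans (Nat.le_add_right _ _)

/-- The exponent is polynomial in `q` and `e`, which is what survives a fixed number of
eliminations. -/
theorem elimBound_two_pow_le (q e : ℕ) : elimBound q (2 ^ e) ≤ 2 ^ (2 * q ^ 2 + e * (q + 2)) := by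
  have h1 : q.factorial ≤ 2 ^ q ^ 2 := by
    calc q.factorial ≤ q ^ q := Nat.factorial_le_pow q
      _ ≤ (2 ^ q) ^ q := Nat.pow_le_pow_left Nat.lt_two_pow_self.le q
      _ = 2 ^ q ^ 2 := by rw [← pow_mul, sq]
  have h2 : 1 + q ^ 2 ≤ 2 ^ q ^ 2 := by
    have := @Nat.lt_two_pow_self (q ^ 2)
    omega
  have hM : 1 ≤ 2 ^ e := Nat.one_le_two_pow
  calc elimBound q (2 ^ e)
      ≤ q.factorial * (2 ^ e) ^ q * (2 ^ e * 2 ^ e) * (1 + q ^ 2) := by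
        have : q.factorial * (2 ^ e) ^ q * 2 ^ e * 1 ≤ q.factorial * (2 ^ e) ^ q * 2 ^ e * 2 ^ e :=
          Nat.mul_le_mul_left _ hM
        simp only [elimBound]
        nlinarith
    _ ≤ 2 ^ q ^ 2 * (2 ^ e) ^ q * (2 ^ e * 2 ^ e) * 2 ^ q ^ 2 := by gcongr
    _ = 2 ^ (2 * q ^ 2 + e * (q + 2)) := by
        rw [← pow_mul, ← pow_add, ← pow_add, ← pow_add, ← pow_add]
        congr 1
        ring

/-- With `q` the cardinality of `κ`, `K = q! * M ^ q` and `R = q * (K * M)`, the bound is exactly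
`elimBound q M`. -/
theorem abs_combination_le {κ : Type} [Fintype κ] {M K R : ℕ} {D c : ℤ} {a w : κ → ℤ}
    (hD₀ : 0 < D) (hD : D ≤ K) (hc : |c| ≤ M) (ha : ∀ k, |a k| ≤ M) (hw : ∀ k, |w k| ≤ R) :
    |D * c + ∑ k, a k * w k| ≤ (K * M + Fintype.card κ * (M * R) : ℕ) := by
  calc |D * c + ∑ k, a k * w k| ≤ |D * c| + ∑ k, |a k * w k| :=
        (abs_add_le _ _).trans (add_le_add le_rfl (Finset.abs_sum_le_sum_abs _ _))
    _ ≤ K * M + ∑ _k : κ, (M * R : ℤ) := by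
        refine add_le_add ?_ (Finset.sum_le_sum fun k _ => ?_)
        · rw [abs_mul, abs_of_pos hD₀]
          exact mul_le_mul hD hc (abs_nonneg _) (by positivity)
        · rw [abs_mul]
          exact mul_le_mul (ha k) (hw k) (abs_nonneg _) (by positivity)
    _ = (K * M + Fintype.card κ * (M * R) : ℕ) := by simp

/-- The parametric basic solutions for the system of all sign conditions that hold at `(x, y)`. -/
theorem exists_sign_parametrization {ι κ : Type} [Fintype ι] [Fintype κ] {M : ℕ} (hM : 1 ≤ M)
    (x : ι → ℝ) (y : κ → ℝ) :
    ∃ (D : ℤ) (W : κ → ι → ℤ) (W₀ v : κ → ℤ), 0 < D ∧ D ≤ elimBound (Fintype.card κ) M ∧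
      (∀ k, |W₀ k| ≤ elimBound (Fintype.card κ) M) ∧
      (∀ k, |v k| ≤ elimBound (Fintype.card κ) M) ∧
      ∀ (a : ι ⊕ κ → ℤ) (β : ℤ), (∀ i, |a i| ≤ M) → |β| ≤ M →
        ∃ (g : ι → ℤ) (g₀ h : ℤ), (∀ i, |g i| ≤ elimBound (Fintype.card κ) M) ∧
          |g₀| ≤ elimBound (Fintype.card κ) M ∧ |h| ≤ elimBound (Fintype.card κ) M ∧
          (∀ (x' : ι → ℝ) (ε : ℝ),
            affForm a β (Sum.elim x' fun k => (affForm (W k) (W₀ k) x' + ε * v k) / D) =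
              (affForm g g₀ x' + ε * h) / D) ∧
          (0 < affForm a β (Sum.elim x y) →
            0 < affForm g g₀ x ∨ affForm g g₀ x = 0 ∧ 0 < h) ∧
          (affForm a β (Sum.elim x y) = 0 → affForm g g₀ x = 0 ∧ h = 0) := by
  classical
  -- `F` encodes the finitely many bounded forms. The system consists of those nonnegative at `(x,
  -- y)`, marked strict where they are positive.
  let F : Type := (ι ⊕ κ → Set.Icc (-M : ℤ) M) × Set.Icc (-M : ℤ) M
  let val : F → ℝ := fun f => affForm (fun i => (f.1 i : ℤ)) f.2 (Sum.elim x y)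
  have hval : ∀ f : F, val f = affForm (fun i => (f.1 (Sum.inl i) : ℤ)) f.2 x +
      ∑ k, ((f.1 (Sum.inr k) : ℤ) : ℝ) * y k := fun f => affForm_sumElim _ _ _ _
  obtain ⟨D, W, W₀, v, hD₀, hD, hW, hW₀, hv, H⟩ := exists_basic_parametrization
    (m := {f : F // 0 ≤ val f}) hM (fun f i => (f.1.1 (Sum.inl i) : ℤ))
    (fun f k => (f.1.1 (Sum.inr k) : ℤ)) (fun f => f.1.2) (fun f => if 0 < val f.1 then 1 else 0)
    (fun f i => abs_le.mpr (f.1.1 _).2) (fun f k => abs_le.mpr (f.1.1 _).2)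
    (fun f => abs_le.mpr f.1.2.2) (fun f => by split_ifs <;> simp) x y
    (fun f => by rw [← hval]; exact f.2) (fun f hf => by
      rw [← hval]
      by_contra h
      simp [h] at hf)
  refine ⟨D, W, W₀, v, hD₀, hD.trans (by exact_mod_cast factorial_mul_le_elimBound _ hM),
    fun k => (hW₀ k).trans (by exact_mod_cast mul_le_elimBound _ hM),
    fun k => (hv k).trans (by exact_mod_cast mul_le_elimBound _ hM), fun a β ha hβ => ?_⟩
  have hDR : (D : ℝ) ≠ 0 := by exact_mod_cast hD₀.ne'
  have pos : ∀ (a : ι ⊕ κ → ℤ) (β : ℤ), (∀ i, |a i| ≤ M) → |β| ≤ M →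
      0 ≤ affForm a β (Sum.elim x y) →
      0 < affForm (fun i => D * a (Sum.inl i) + ∑ k, a (Sum.inr k) * W k i)
        (D * β + ∑ k, a (Sum.inr k) * W₀ k) x ∨
      affForm (fun i => D * a (Sum.inl i) + ∑ k, a (Sum.inr k) * W k i)
        (D * β + ∑ k, a (Sum.inr k) * W₀ k) x = 0 ∧
        D * (if 0 < affForm a β (Sum.elim x y) then 1 else 0) ≤ ∑ k, a (Sum.inr k) * v k :=
    fun a β ha hβ h => H ⟨(fun i => ⟨a i, abs_le.mp (ha i)⟩, ⟨β, abs_le.mp hβ⟩), h⟩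
  refine ⟨fun i => D * a (Sum.inl i) + ∑ k, a (Sum.inr k) * W k i,
    D * β + ∑ k, a (Sum.inr k) * W₀ k, ∑ k, a (Sum.inr k) * v k,
    fun i => abs_combination_le hD₀ hD (ha _) (fun k => ha _) (fun k => hW k i),
    abs_combination_le hD₀ hD hβ (fun k => ha _) hW₀, ?_, fun x' ε => ?_, fun hpos => ?_,
    fun hzero => ?_⟩
  · have := abs_combination_le hD₀ hD (c := 0) (by simp) (fun k => ha (Sum.inr k)) hv
    simpa [elimBound] using this
  · have h2 := sum_mul_affForm (fun k => a (Sum.inr k)) W W₀ v x' ε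
    rw [affForm_add_smul, affForm_sumElim, eq_div_iff hDR, add_mul, Finset.sum_mul]
    rw [add_assoc, ← h2, mul_comm (D : ℝ)]
    congr 1
    exact Finset.sum_congr rfl fun k _ => by field_simp
  · rcases pos a β ha hβ hpos.le with h | ⟨h, h'⟩
    · exact Or.inl h
    · rw [if_pos hpos, mul_one] at h'
      exact Or.inr ⟨h, hD₀.trans_le h'⟩
  -- A form vanishing at `(x, y)` is in the system together with its negative; the two lexicographic
  -- inequalities force both parts to vanish.
  · have h1 := pos a β ha hβ hzero.ge
    have h2 := pos (fun i => -a i) (-β) (fun i => by rw [abs_neg]; exact ha i)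
      (by rwa [abs_neg]) (by rw [affForm_neg, hzero, neg_zero])
    have e1 : (fun i => D * -a (Sum.inl i) + ∑ k, -a (Sum.inr k) * W k i) =
        fun i => -(D * a (Sum.inl i) + ∑ k, a (Sum.inr k) * W k i) := by
      ext i; simp only [neg_mul, Finset.sum_neg_distrib]; ring
    have e2 : D * -β + ∑ k, -a (Sum.inr k) * W₀ k = -(D * β + ∑ k, a (Sum.inr k) * W₀ k) := by
      simp only [neg_mul, Finset.sum_neg_distrib]; ring
    rw [e1, e2, affForm_neg, affForm_neg, hzero] at h2
    rw [hzero] at h1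
    simp only [neg_zero, lt_irrefl, if_false, mul_zero, neg_mul, Finset.sum_neg_distrib,
      neg_pos, neg_eq_zero, neg_nonneg] at h1 h2
    rcases h1 with h1 | ⟨h1, h1'⟩ <;> rcases h2 with h2 | ⟨h2, h2'⟩
    · exact absurd h1 h2.not_gt
    · exact absurd h2 h1.ne'
    · exact absurd h1 h2.ne
    · exact ⟨h1, le_antisymm h2' h1'⟩

/-- Back-and-forth: similar points have similar extensions. -/
theorem Sim.exists_extension {ι κ : Type} [Fintype ι] [Fintype κ] {M : ℕ} (hM : 1 ≤ M)
    {x x' : ι → ℝ} (h : Sim (elimBound (Fintype.card κ) M) x x') (y : κ → ℝ) :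
    ∃ y' : κ → ℝ, Sim M (Sum.elim x y) (Sum.elim x' y') := by
  obtain ⟨D, W, W₀, v, hD₀, -, -, -, H⟩ := exists_sign_parametrization hM x y
  have hDR : (0 : ℝ) < D := by exact_mod_cast hD₀
  let Y : ℝ → κ → ℝ := fun ε k => (affForm (W k) (W₀ k) x' + ε * v k) / D
  -- The substituted forms have equal signs at `x` and `x'`, and as there are finitely many, one `ε`
  -- works for all.
  have hev : ∀ᶠ ε in 𝓝[>] (0 : ℝ), ∀ f : (ι ⊕ κ → Set.Icc (-M : ℤ) M) × Set.Icc (-M : ℤ) M,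
      0 < affForm (fun i => (f.1 i : ℤ)) f.2 (Sum.elim x y) →
        0 < affForm (fun i => (f.1 i : ℤ)) f.2 (Sum.elim x' (Y ε)) := by
    rw [eventually_all]
    intro f
    obtain ⟨g, g₀, l, hg, hg₀, -, hY, hpos, -⟩ := H (fun i => (f.1 i : ℤ)) f.2
      (fun i => abs_le.mpr (f.1 i).2) (abs_le.mpr f.2.2)
    by_cases hf : 0 < affForm (fun i => (f.1 i : ℤ)) f.2 (Sum.elim x y)
    · have hlex : 0 < affForm g g₀ x' ∨ affForm g g₀ x' = 0 ∧ 0 < (l : ℝ) := by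
        rw [← h.pos_iff hg hg₀, ← h.eq_zero_iff hg hg₀]
        exact_mod_cast hpos hf
      filter_upwards [eventually_lex_pos hlex] with ε hε _
      rw [hY]
      exact div_pos hε hDR
    · exact Eventually.of_forall fun ε hf' => absurd hf' hf
  obtain ⟨ε, hε⟩ := hev.exists
  refine ⟨Y ε, Sim.of_pos_of_zero fun a β ha hβ => ⟨fun hpos => ?_, fun hzero => ?_⟩⟩
  · exact hε (fun i => ⟨a i, abs_le.mp (ha i)⟩, ⟨β, abs_le.mp hβ⟩) hpos
  · obtain ⟨g, g₀, l, hg, hg₀, -, hY, -, hz⟩ := H a β ha hβ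
    obtain ⟨h1, h2⟩ := hz hzero
    rw [hY, (h.eq_zero_iff hg hg₀).1 h1, h2]
    simp

/-- Every point is similar to a rational point with small numerators and denominators. -/
theorem exists_rat_sim {κ : Type} [Fintype κ] {M : ℕ} (hM : 1 ≤ M) (y : κ → ℝ) :
    ∃ q : κ → ℚ, Sim M y (fun k => (q k : ℝ)) ∧ ∀ k, ∃ a b : ℤ, q k = a / b ∧ 0 < b ∧
      |a| ≤ ((elimBound (Fintype.card κ) M + 1) ^ 2 : ℕ) ∧
      b ≤ ((elimBound (Fintype.card κ) M + 1) ^ 2 : ℕ) := by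
  obtain ⟨D, W, W₀, v, hD₀, hD, hW₀, hv, H⟩ :=
    exists_sign_parametrization (ι := Empty) hM (fun i => i.elim) y
  set N := elimBound (Fintype.card κ) M
  have hDR : (0 : ℝ) < D := by exact_mod_cast hD₀
  have hN : (0 : ℝ) < N + 1 := by positivity
  -- Without parameters the leading part `g₀` is an integer and the `ε`-part is at least `-N`, so `ε
  -- = 1 / (N + 1)` is already small enough.
  let q : κ → ℚ := fun k => ((W₀ k * (N + 1) + v k : ℤ) : ℚ) / ((D * (N + 1) : ℤ) : ℚ)
  have hq : (fun k => (q k : ℝ)) = fun k =>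
      (affForm (W k) (W₀ k) (fun i : Empty => (i.elim : ℝ)) + 1 / (N + 1) * v k) / D := by
    ext k
    simp only [q, affForm, Finset.univ_eq_empty, Finset.sum_empty]
    push_cast
    field_simp
    ring
  refine ⟨q, Sim.inr (ι := Empty) (x := fun i => i.elim) (x' := fun i => i.elim)
    (Sim.of_pos_of_zero fun a β ha hβ => ?_), fun k => ⟨_, _, rfl, by positivity, ?_, ?_⟩⟩
  · obtain ⟨g, g₀, l, -, -, hl, hY, hpos, hzero⟩ := H a β ha hβ
    have hg : affForm g g₀ (fun i : Empty => (i.elim : ℝ)) = g₀ := by simp [affForm]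
    rw [hq, hY, hg]
    rw [hg] at hpos hzero
    refine ⟨fun h => div_pos ?_ hDR, fun h => ?_⟩
    · rcases hpos h with h1 | ⟨h1, h2⟩
      · have h3 : (1 : ℝ) ≤ g₀ := by
          have : (0 : ℤ) < g₀ := by exact_mod_cast h1
          exact_mod_cast this
        have h4 : -(N : ℝ) ≤ l := by exact_mod_cast (abs_le.mp hl).1
        have h5 : 0 < (g₀ : ℝ) * (N + 1) + l := by nlinarith
        have h6 : (g₀ : ℝ) + 1 / (N + 1) * l = (g₀ * (N + 1) + l) / (N + 1) := by field_simp
        rw [h6]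
        exact div_pos h5 hN
      · have h3 : (0 : ℝ) < l := by exact_mod_cast h2
        rw [h1]
        positivity
    · obtain ⟨h1, h2⟩ := hzero h
      rw [h1, h2]
      simp
  · have h1 : |W₀ k * (N + 1) + v k| ≤ |W₀ k| * (N + 1) + |v k| := by
      refine (abs_add_le _ _).trans (add_le_add ?_ le_rfl)
      rw [abs_mul, abs_of_pos (by positivity : (0 : ℤ) < N + 1)]
    have h2 : |W₀ k| * ((N : ℤ) + 1) ≤ N * (N + 1) :=
      mul_le_mul_of_nonneg_right (hW₀ k) (by positivity)
    push_cast
    nlinarith [hv k]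
  · have h2 : D * ((N : ℤ) + 1) ≤ N * (N + 1) := mul_le_mul_of_nonneg_right hD (by positivity)
    push_cast
    nlinarith

end MultilevelLP
-- Saturated sets: minimization, infima, rational descriptions.
namespace MultilevelLP

open Filter Topology

/-- A set is `M`-saturated if it is a union of classes of `M`-similarity. -/
def Saturated {ι : Type} [Fintype ι] (M : ℕ) (S : Set (ι → ℝ)) : Prop :=
  ∀ ⦃x x' : ι → ℝ⦄, Sim M x x' → x ∈ S → x' ∈ S

theorem Saturated.mono {ι : Type} [Fintype ι] {M N : ℕ} (hMN : M ≤ N) {S : Set (ι → ℝ)}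
    (h : Saturated M S) : Saturated N S :=
  fun _ _ hx => h (hx.mono hMN)

/-- Minimizing an affine form over a saturated set while keeping some coordinates fixed. -/
theorem Saturated.argmin_fiber {ι : Type} [Fintype ι] {M : ℕ} (hM : 1 ≤ M) {S : Set (ι → ℝ)}
    (hS : Saturated M S) (o : ι → ℤ) (ho : ∀ i, |o i| ≤ M) (J : ι → Prop) :
    Saturated (elimBound (Fintype.card ι) M)
      {x | x ∈ S ∧ ∀ y ∈ S, (∀ i, J i → y i = x i) → affForm o 0 x ≤ affForm o 0 y} := by
  classical
  rintro x x' hxx' ⟨hx, hmin⟩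
  refine ⟨hS (hxx'.mono (le_elimBound _ hM)) hx, fun y' hy' hJ => ?_⟩
  -- A competitor of `x'` is pulled back to one of `x`. Agreement on `J` and comparison of
  -- objectives are sign conditions on small forms in the pair.
  obtain ⟨y, hy⟩ := hxx'.symm.exists_extension hM y'
  have hyS : y ∈ S := hS hy.inr hy'
  have hobj : ∀ u w : ι → ℝ, affForm (Sum.elim o fun i => -o i) 0 (Sum.elim u w) =
      affForm o 0 u - affForm o 0 w := by
    intro u w
    rw [affForm_sumElim]
    simp only [Sum.elim_inl, Sum.elim_inr, affForm, Int.cast_neg, neg_mul,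
      Finset.sum_neg_distrib]
    ring
  have hle := hmin y hyS fun i hi => by
    have hform : ∀ u w : ι → ℝ, affForm (Sum.elim (Pi.single i 1) (Pi.single i (-1))) 0
        (Sum.elim u w) = u i - w i := by
      intro u w
      simp [affForm, Pi.single_apply, sub_eq_add_neg]
    have h := hy.eq_zero_iff (a := Sum.elim (Pi.single i 1) (Pi.single i (-1))) (β := 0) (by
      rintro (j | j) <;> simp only [Sum.elim_inl, Sum.elim_inr, Pi.single_apply] <;> split_ifs <;>
        simp [hM]) (by simp)
    rw [hform, hform, hJ i hi, sub_self] at h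
    exact (sub_eq_zero.mp (h.mp rfl)).symm
  have h := hy.nonpos_iff (a := Sum.elim o fun i => -o i) (β := 0)
    (by rintro (j | j) <;> simp [ho]) (by simp)
  rw [hobj, hobj, sub_nonpos, sub_nonpos] at h
  exact h.mpr hle

/-- A witness `x` of the value `t` is carried to the similar value `t'`, since the form `o - t`
keeps its zero. -/
theorem Saturated.image_affForm {ι : Type} [Fintype ι] {M : ℕ} (hM : 1 ≤ M) {S : Set (ι → ℝ)}
    (hS : Saturated M S) (o : ι → ℤ) (ho : ∀ i, |o i| ≤ M) :
    Saturated (elimBound (Fintype.card ι) M)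
      {t : Unit → ℝ | ∃ x ∈ S, affForm o 0 x = t ()} := by
  rintro t t' htt' ⟨x, hx, hxt⟩
  obtain ⟨x', hx'⟩ := htt'.exists_extension hM x
  refine ⟨x', hS hx'.inr hx, ?_⟩
  have hform : ∀ (u : Unit → ℝ) (w : ι → ℝ), affForm (Sum.elim (fun _ => -1) o) 0
      (Sum.elim u w) = affForm o 0 w - u () := by
    intro u w
    rw [affForm_sumElim]
    simp only [affForm, Sum.elim_inl, Sum.elim_inr, Finset.univ_unique,
      Finset.sum_singleton, Int.cast_neg, Int.cast_one, Int.cast_zero, PUnit.default_eq_unit]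
    ring
  have h := hx'.eq_zero_iff (a := Sum.elim (fun _ => -1) o) (β := 0)
    (by rintro (j | j) <;> simp [ho, hM]) (by simp)
  rw [hform, hform, hxt, sub_self] at h
  exact sub_eq_zero.mp (h.mp rfl)

/-- The infimum of a saturated set of reals is a root of an affine form with small
coefficients. -/
theorem Saturated.isGLB_eq_div {N : ℕ} {V : Set (Unit → ℝ)} (hV : Saturated N V) {r : ℝ}
    (hr : IsGLB {t : ℝ | (fun _ => t) ∈ V} r) :
    ∃ a b : ℤ, 0 < b ∧ |a| ≤ N ∧ b ≤ N ∧ r = a / b := by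
  have hval : ∀ (a : Unit → ℤ) (β : ℤ) (t : ℝ), affForm a β (fun _ => t) = a () * t + β := by
    intro a β t
    simp [affForm]
  -- Otherwise only the zero form vanishes at `r`, so a whole neighborhood of `r` is one class. It
  -- meets `V`, hence `V` has points below its infimum.
  by_contra hcon
  push Not at hcon
  have hroot : ∀ a β : ℤ, |a| ≤ N → |β| ≤ N → a * r + β = 0 → a = 0 := by
    intro a β ha hβ h0
    by_contra hne
    rcases lt_or_gt_of_ne hne with h | h
    · have hR : (a : ℝ) < 0 := by exact_mod_cast h
      refine hcon β (-a) (by omega) hβ (by rw [abs_of_neg h] at ha; exact ha) ?_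
      rw [eq_div_iff (by push_cast; linarith)]
      push_cast
      linarith
    · have hR : (0 : ℝ) < a := by exact_mod_cast h
      refine hcon (-β) a h (by rwa [abs_neg]) (by rw [abs_of_pos h] at ha; exact ha) ?_
      rw [eq_div_iff hR.ne']
      push_cast
      linarith
  have hev : ∀ᶠ t in 𝓝 r, ∀ f : (Unit → Set.Icc (-N : ℤ) N) × Set.Icc (-N : ℤ) N,
      0 < ((f.1 () : ℤ) : ℝ) * r + (f.2 : ℤ) → 0 < ((f.1 () : ℤ) : ℝ) * t + (f.2 : ℤ) := by
    rw [eventually_all]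
    intro f
    by_cases hf : 0 < ((f.1 () : ℤ) : ℝ) * r + (f.2 : ℤ)
    · have : Tendsto (fun t : ℝ => ((f.1 () : ℤ) : ℝ) * t + (f.2 : ℤ)) (𝓝 r)
          (𝓝 (((f.1 () : ℤ) : ℝ) * r + (f.2 : ℤ))) :=
        ((continuous_const.mul continuous_id).add continuous_const).tendsto r
      filter_upwards [this.eventually (lt_mem_nhds hf)] with t ht _
      exact ht
    · exact Eventually.of_forall fun t h => absurd h hf
  have hsim : ∀ᶠ t in 𝓝 r, Sim N (fun _ : Unit => r) (fun _ => t) := by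
    filter_upwards [hev] with t ht
    refine Sim.of_pos_of_zero fun a β ha hβ => ?_
    rw [hval, hval]
    refine ⟨fun h => ht (fun i => ⟨a i, abs_le.mp (ha i)⟩, ⟨β, abs_le.mp hβ⟩) h, fun h => ?_⟩
    have h0 := hroot _ _ (ha ()) hβ h
    rw [h0] at h ⊢
    simpa using h
  obtain ⟨δ, hδ, hball⟩ := Metric.eventually_nhds_iff.mp hsim
  obtain ⟨t, ht, hrt, htδ⟩ := hr.exists_between (show r < r + δ by linarith)
  have hrV : (fun _ : Unit => r) ∈ V :=
    hV (hball (y := t) (by rw [Real.dist_eq, abs_lt]; constructor <;> linarith)).symm ht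
  have hlow : (fun _ : Unit => r - δ / 2) ∈ V :=
    hV (hball (y := r - δ / 2) (by rw [Real.dist_eq, abs_lt]; constructor <;> linarith)) hrV
  have := hr.1 hlow
  linarith

/-- Reduction to lowest terms only shrinks numerator and denominator; the bound is `1 + (t + 1) + (t
+ 1)`. -/
theorem ratSize_div_le {a b : ℤ} {t : ℕ} (hb : 0 < b) (ha : |a| ≤ (2 ^ t : ℕ))
    (hb' : b ≤ (2 ^ t : ℕ)) : ratSize ((a : ℚ) / b) ≤ 2 * t + 3 := by
  have hclog : ∀ m : ℕ, m ≤ 2 ^ t → Nat.clog 2 (m + 1) ≤ t + 1 := by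
    intro m hm
    rw [Nat.clog_le_iff_le_pow (by norm_num), pow_succ]
    have := @Nat.one_le_two_pow t
    omega
  have hden : ((a : ℚ) / b).den ≤ 2 ^ t := by
    have := Int.le_of_dvd hb (Rat.den_dvd a b)
    rw [Rat.divInt_eq_div] at this
    exact_mod_cast this.trans hb'
  have hnum : ((a : ℚ) / b).num.natAbs ≤ 2 ^ t := by
    rcases eq_or_ne a 0 with rfl | ha0
    · simp
    · have h1 := Int.natAbs_dvd_natAbs.mpr (Rat.num_dvd a hb.ne')
      rw [Rat.divInt_eq_div] at h1
      have h2 := Nat.le_of_dvd (Int.natAbs_pos.mpr ha0) h1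
      have h3 : (a.natAbs : ℤ) ≤ (2 ^ t : ℕ) := by rwa [Int.natCast_natAbs]
      exact h2.trans (by exact_mod_cast h3)
  have h1 := hclog _ hden
  have h2 := hclog _ hnum
  simp only [ratSize]
  omega

theorem ratSize_intCast_le {a : ℤ} {t : ℕ} (ha : |a| ≤ (2 ^ t : ℕ)) :
    ratSize (a : ℚ) ≤ 2 * t + 3 := by
  simpa using ratSize_div_le (b := 1) one_pos ha (by exact_mod_cast Nat.one_le_two_pow)

theorem abs_num_le_two_pow_ratSize (q : ℚ) : |q.num| ≤ (2 ^ ratSize q : ℕ) := by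
  have h1 := Nat.le_pow_clog (b := 2) (by norm_num) (q.num.natAbs + 1)
  have h2 : 2 ^ Nat.clog 2 (q.num.natAbs + 1) ≤ 2 ^ ratSize q :=
    Nat.pow_le_pow_right (by norm_num) (by simp only [ratSize]; omega)
  rw [← Int.natCast_natAbs]
  exact_mod_cast (by omega : q.num.natAbs ≤ 2 ^ ratSize q)

theorem den_le_two_pow_ratSize (q : ℚ) : q.den ≤ 2 ^ ratSize q := by
  have h1 := Nat.le_pow_clog (b := 2) (by norm_num) (q.den + 1)
  have h2 : 2 ^ Nat.clog 2 (q.den + 1) ≤ 2 ^ ratSize q :=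
    Nat.pow_le_pow_right (by norm_num) (by simp only [ratSize]; omega)
  omega

/-- Clearing denominators. -/
theorem exists_clear_denominators {ι : Type} [Fintype ι] (s : ℕ) (a : ι → ℚ) (b : ℚ)
    (ha : ∀ i, a i = 0 ∨ ratSize (a i) ≤ s) (hb : b = 0 ∨ ratSize b ≤ s) :
    ∃ (Δ : ℕ) (a' : ι → ℤ) (b' : ℤ), 0 < Δ ∧ Δ ≤ 2 ^ (s * (Fintype.card ι + 2)) ∧
      (∀ i, (a' i : ℚ) = Δ * a i) ∧ (b' : ℚ) = Δ * b ∧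
      (∀ i, |a' i| ≤ (2 ^ (s * (Fintype.card ι + 2)) : ℕ)) ∧
      |b'| ≤ (2 ^ (s * (Fintype.card ι + 2)) : ℕ) := by
  have hnum : ∀ q : ℚ, q = 0 ∨ ratSize q ≤ s → |q.num| ≤ (2 ^ s : ℕ) := by
    rintro q (rfl | h)
    · simp
    · exact (abs_num_le_two_pow_ratSize q).trans
        (by exact_mod_cast Nat.pow_le_pow_right (by norm_num) h)
  have hden : ∀ q : ℚ, q = 0 ∨ ratSize q ≤ s → q.den ≤ 2 ^ s := by
    rintro q (rfl | h)
    · simpa using Nat.one_le_two_pow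
    · exact (den_le_two_pow_ratSize q).trans (Nat.pow_le_pow_right (by norm_num) h)
  -- The product of `card ι + 1` denominators; a numerator adds one more factor `2 ^ s`.
  set Δ := b.den * ∏ i, (a i).den with hΔ
  have hΔpos : 0 < Δ := Nat.mul_pos b.den_pos (Finset.prod_pos fun i _ => (a i).den_pos)
  have hΔle : Δ ≤ 2 ^ (s * (Fintype.card ι + 1)) := by
    calc Δ ≤ 2 ^ s * ∏ _i : ι, 2 ^ s :=
          Nat.mul_le_mul (hden b hb) (Finset.prod_le_prod' fun i _ => hden _ (ha i))
      _ = 2 ^ (s * (Fintype.card ι + 1)) := by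
          rw [Finset.prod_const, Finset.card_univ, ← pow_succ', ← pow_mul]
  have hpow : 2 ^ s * 2 ^ (s * (Fintype.card ι + 1)) = 2 ^ (s * (Fintype.card ι + 2)) := by
    rw [← pow_add]; congr 1; ring
  have key : ∀ q : ℚ, q = 0 ∨ ratSize q ≤ s → q.den ∣ Δ →
      ∃ z : ℤ, (z : ℚ) = Δ * q ∧ |z| ≤ (2 ^ (s * (Fintype.card ι + 2)) : ℕ) := by
    rintro q hq ⟨d, hd⟩
    refine ⟨q.num * d, ?_, ?_⟩
    · have h := Rat.mul_den_eq_num q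
      rw [hd]
      push_cast
      rw [← h]
      ring
    · have hdle : d ≤ 2 ^ (s * (Fintype.card ι + 1)) :=
        (Nat.le_of_dvd hΔpos ⟨q.den, by rw [hd, mul_comm]⟩).trans hΔle
      rw [abs_mul, ← hpow, Nat.abs_cast]
      push_cast
      exact mul_le_mul (by exact_mod_cast hnum q hq) (by exact_mod_cast hdle) (by positivity)
        (by positivity)
  have ha' := fun i => key (a i) (ha i)
    ((Finset.dvd_prod_of_mem (fun i => (a i).den) (Finset.mem_univ i)).mul_left _)
  choose a' ha₁ ha₂ using ha'
  obtain ⟨b', hb₁, hb₂⟩ := key b hb (Dvd.intro _ rfl)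
  exact ⟨Δ, a', b', hΔpos, hΔle.trans (Nat.pow_le_pow_right (by norm_num)
    (Nat.mul_le_mul_left _ (by omega))), ha₁, hb₁, ha₂, hb₂⟩

theorem saturated_halfspace {ι : Type} [Fintype ι] (s : ℕ) (a : ι → ℚ) (b : ℚ)
    (ha : ∀ i, a i = 0 ∨ ratSize (a i) ≤ s) (hb : b = 0 ∨ ratSize b ≤ s) :
    Saturated (2 ^ (s * (Fintype.card ι + 2))) {x : ι → ℝ | (b : ℝ) ≤ ∑ i, (a i : ℝ) * x i} := by
  obtain ⟨Δ, a', b', hΔ, -, ha', hb', hab, hbb⟩ := exists_clear_denominators s a b ha hb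
  have hΔR : (0 : ℝ) < Δ := by exact_mod_cast hΔ
  have haR : ∀ i, (a' i : ℝ) = Δ * a i := fun i => by exact_mod_cast congrArg (Rat.cast (K := ℝ)) (ha' i)
  have hbR : (b' : ℝ) = Δ * b := by exact_mod_cast congrArg (Rat.cast (K := ℝ)) hb'
  have hform : ∀ x : ι → ℝ, 0 ≤ affForm a' (-b') x ↔ (b : ℝ) ≤ ∑ i, (a i : ℝ) * x i := by
    intro x
    have : affForm a' (-b') x = Δ * (∑ i, (a i : ℝ) * x i - b) := by
      simp only [affForm, haR, Int.cast_neg, hbR, mul_sub, Finset.mul_sum, mul_assoc]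
      ring
    rw [this, mul_nonneg_iff_of_pos_left hΔR, sub_nonneg]
  intro x x' hx h
  exact (hform x').mp ((hx a' (-b') hab (by rwa [abs_neg])).mp ((hform x).mpr h))

/-- A saturated set is a finite union of rational generalized polyhedra with small
coefficients. -/
theorem Saturated.exists_iUnion {ι : Type} [Fintype ι] {e : ℕ} {S : Set (ι → ℝ)}
    (hS : Saturated (2 ^ e) S) :
    ∃ (N : ℕ) (Q : Fin N → Set (ι → ℝ)), (∀ t, IsRatGenPolyhedron (2 * e + 3) (Q t)) ∧
      S = ⋃ t, Q t := by
  classical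
  set M : ℕ := 2 ^ e
  let F : Type := (ι → Set.Icc (-M : ℤ) M) × Set.Icc (-M : ℤ) M
  let val : F → (ι → ℝ) → ℝ := fun f x => affForm (fun i => (f.1 i : ℤ)) f.2 x
  -- The set of forms nonnegative at `x` determines its class: these give weak inequalities, the
  -- remaining forms strict ones.
  let pos : (ι → ℝ) → Set F := fun x => {f | 0 ≤ val f x}
  have hsim : ∀ x x', pos x = pos x' → Sim M x x' := fun x x' h a β ha hβ =>
    Set.ext_iff.mp h (fun i => ⟨a i, abs_le.mp (ha i)⟩, ⟨β, abs_le.mp hβ⟩)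
  let T : Type := {t : Set F // ∃ x ∈ S, pos x = t}
  obtain ⟨N, ⟨eq⟩⟩ := Finite.exists_equiv_fin T
  refine ⟨N, fun i => {x | pos x = (eq.symm i).1}, fun i => ?_, ?_⟩
  · set t := (eq.symm i).1
    obtain ⟨m, ⟨e₁⟩⟩ := Finite.exists_equiv_fin {f : F // f ∈ t}
    obtain ⟨m', ⟨e₂⟩⟩ := Finite.exists_equiv_fin {f : F // f ∉ t}
    have hsize : ∀ z : Set.Icc (-M : ℤ) M, ratSize ((z : ℤ) : ℚ) ≤ 2 * e + 3 :=
      fun z => ratSize_intCast_le (abs_le.mpr z.2)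
    have hsize' : ∀ z : Set.Icc (-M : ℤ) M, ratSize ((-(z : ℤ) : ℤ) : ℚ) ≤ 2 * e + 3 :=
      fun z => ratSize_intCast_le (by rw [abs_neg]; exact abs_le.mpr z.2)
    refine ⟨m, m', fun r j => (((e₁.symm r).1.1 j : ℤ) : ℚ),
      fun r => ((-((e₁.symm r).1.2 : ℤ) : ℤ) : ℚ),
      fun r j => ((-((e₂.symm r).1.1 j : ℤ) : ℤ) : ℚ), fun r => (((e₂.symm r).1.2 : ℤ) : ℚ),
      fun r j => hsize _, fun r => hsize' _, fun r j => hsize' _, fun r => hsize _, ?_⟩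
    ext x
    have h1 : (∀ f ∈ t, 0 ≤ val f x) ↔ ∀ r, ((((-((e₁.symm r).1.2 : ℤ) : ℤ) : ℚ)) : ℝ) ≤
        ∑ j, ((((e₁.symm r).1.1 j : ℤ) : ℚ) : ℝ) * x j := by
      rw [← Subtype.forall (p := fun f => f ∈ t) (q := fun f => 0 ≤ val f.1 x),
        ← e₁.symm.forall_congr_right]
      refine forall_congr' fun r => ?_
      simp only [val, affForm]
      push_cast
      exact neg_le_iff_add_nonneg.symm
    have h2 : (∀ f, f ∉ t → ¬ 0 ≤ val f x) ↔ ∀ r, (((((e₂.symm r).1.2 : ℤ) : ℚ)) : ℝ) <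
        ∑ j, (((-((e₂.symm r).1.1 j : ℤ) : ℤ) : ℚ) : ℝ) * x j := by
      rw [← Subtype.forall (p := fun f => f ∉ t) (q := fun f => ¬ 0 ≤ val f.1 x),
        ← e₂.symm.forall_congr_right]
      refine forall_congr' fun r => ?_
      simp only [val, affForm, not_le]
      push_cast
      simp only [neg_mul, Finset.sum_neg_distrib]
      constructor <;> intro h <;> linarith
    change pos x = t ↔ _ ∧ _
    rw [← h1, ← h2, ← forall_and, Set.ext_iff]
    refine forall_congr' fun f => ?_
    change (0 ≤ val f x ↔ f ∈ t) ↔ _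
    tauto
  · ext x
    rw [Set.mem_iUnion]
    constructor
    · exact fun hx => ⟨eq ⟨pos x, x, hx, rfl⟩, by simp⟩
    · rintro ⟨i, hi⟩
      obtain ⟨x₀, hx₀, h⟩ := (eq.symm i).2
      exact hS (hsim x₀ x (h.trans hi.symm)) hx₀

/-- A nonempty saturated set contains a small rational point. -/
theorem Saturated.exists_rat {ι : Type} [Fintype ι] {e E : ℕ} {S : Set (ι → ℝ)}
    (hS : Saturated (2 ^ e) S) (hne : S.Nonempty)
    (hE : elimBound (Fintype.card ι) (2 ^ e) ≤ 2 ^ E) :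
    ∃ q : ι → ℚ, (fun v => (q v : ℝ)) ∈ S ∧
      vecSize q ≤ Fintype.card ι + Fintype.card ι * (4 * E + 7) := by
  obtain ⟨x, hx⟩ := hne
  obtain ⟨q, hq, hsize⟩ := exists_rat_sim (M := 2 ^ e) Nat.one_le_two_pow x
  have hR : (elimBound (Fintype.card ι) (2 ^ e) + 1) ^ 2 ≤ 2 ^ (2 * E + 2) := by
    have h1 : elimBound (Fintype.card ι) (2 ^ e) + 1 ≤ 2 ^ (E + 1) := by
      have := @Nat.one_le_two_pow E
      rw [pow_succ]
      omega
    calc _ ≤ (2 ^ (E + 1)) ^ 2 := Nat.pow_le_pow_left h1 2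
      _ = 2 ^ (2 * E + 2) := by rw [← pow_mul]; congr 1; ring
  refine ⟨q, hS hq hx, ?_⟩
  have h : ∀ k, ratSize (q k) ≤ 4 * E + 7 := by
    intro k
    obtain ⟨a, b, hab, hb, ha, hb'⟩ := hsize k
    rw [hab]
    have := ratSize_div_le (t := 2 * E + 2) hb (ha.trans (by exact_mod_cast hR))
      (hb'.trans (by exact_mod_cast hR))
    omega
  have := Finset.sum_le_card_nsmul Finset.univ (fun k => ratSize (q k)) _ fun k _ => h k
  rw [Finset.card_univ, smul_eq_mul] at this
  simp only [vecSize]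
  omega

end MultilevelLP
-- Saturation of the feasible and optimal sets of an instance.
namespace MultilevelLP

/-- Exponent of the coefficient bound after `j` elimination steps. -/
noncomputable def expPoly : ℕ → Polynomial ℕ
  | 0 => Polynomial.X * (Polynomial.X + 2)
  | j + 1 => 2 * Polynomial.X ^ 2 + expPoly j * (Polynomial.X + 2)

theorem eval_expPoly_zero (s : ℕ) : (expPoly 0).eval s = s * (s + 2) := by
  simp [expPoly]

theorem eval_expPoly_succ (j s : ℕ) :
    (expPoly (j + 1)).eval s = 2 * s ^ 2 + (expPoly j).eval s * (s + 2) := by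
  simp [expPoly]

theorem eval_expPoly_mono (s : ℕ) : Monotone fun j => (expPoly j).eval s :=
  monotone_nat_of_le_succ fun j => by rw [eval_expPoly_succ]; nlinarith

theorem elimBound_expPoly_le {q s : ℕ} (hq : q ≤ s) (j : ℕ) :
    elimBound q (2 ^ (expPoly j).eval s) ≤ 2 ^ (expPoly (j + 1)).eval s := by
  refine (elimBound_two_pow_le _ _).trans (Nat.pow_le_pow_right (by norm_num) ?_)
  rw [eval_expPoly_succ]
  gcongr

theorem eval_natPoly_mono (p : Polynomial ℕ) : Monotone fun s => p.eval s := by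
  intro s t h
  simp only [Polynomial.eval_eq_sum, Polynomial.sum]
  gcongr

namespace Instance

variable {k : ℕ} (P : Instance k)

theorem card_var : Fintype.card P.Var = P.numVars := by
  simp [numVars]

theorem ratSize_A_le (l i r j) : ratSize (P.A l i r j) ≤ P.maxEntrySize := by
  refine le_trans ?_ (le_max_left _ _)
  refine le_trans ?_ (Finset.le_sup (Finset.mem_univ l))
  refine le_trans ?_ (Finset.le_sup (Finset.mem_univ i))
  refine le_trans ?_ (Finset.le_sup (Finset.mem_univ r))
  exact Finset.le_sup (f := fun j => ratSize (P.A l i r j)) (Finset.mem_univ j)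

theorem ratSize_b_le (l r) : ratSize (P.b l r) ≤ P.maxEntrySize := by
  refine le_trans ?_ (le_max_right _ _)
  refine le_trans ?_ (le_max_left _ _)
  refine le_trans ?_ (Finset.le_sup (Finset.mem_univ l))
  exact Finset.le_sup (f := fun r => ratSize (P.b l r)) (Finset.mem_univ r)

theorem ratSize_c_le {l i} (h : l ≤ i) (j) : ratSize (P.c l i j) ≤ P.maxEntrySize := by
  refine le_trans ?_ (le_max_right _ _)
  refine le_trans ?_ (le_max_right _ _)
  refine le_trans ?_ (Finset.le_sup (Finset.mem_univ l))
  refine le_trans ?_ (Finset.le_sup (Finset.mem_Ici.mpr h))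
  exact Finset.le_sup (f := fun j => ratSize (P.c l i j)) (Finset.mem_univ j)

theorem matSize_le_inputSize (l i) : matSize (P.A l i) ≤ P.inputSize := by
  have h1 := Finset.single_le_sum (f := fun i => matSize (P.A l i))
    (fun _ _ => Nat.zero_le _) (Finset.mem_univ i)
  have h2 := Finset.single_le_sum (f := fun l => ∑ i, matSize (P.A l i))
    (fun _ _ => Nat.zero_le _) (Finset.mem_univ l)
  simp only [inputSize]
  omega

theorem vecSize_b_le_inputSize (l) : vecSize (P.b l) ≤ P.inputSize := by
  have h2 := Finset.single_le_sum (f := fun l => vecSize (P.b l))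
    (fun _ _ => Nat.zero_le _) (Finset.mem_univ l)
  simp only [inputSize]
  omega

theorem vecSize_c_le_inputSize {l i} (h : l ≤ i) : vecSize (P.c l i) ≤ P.inputSize := by
  have h1 := Finset.single_le_sum (f := fun i => vecSize (P.c l i))
    (fun _ _ => Nat.zero_le _) (Finset.mem_Ici.mpr h)
  have h2 := Finset.single_le_sum (f := fun l => ∑ i ∈ Finset.Ici l, vecSize (P.c l i))
    (fun _ _ => Nat.zero_le _) (Finset.mem_univ l)
  simp only [inputSize]
  omega

theorem ratSize_le_vecSize {ι : Type} [Fintype ι] (v : ι → ℚ) (j : ι) :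
    ratSize (v j) ≤ vecSize v := by
  have h1 := Finset.single_le_sum (f := fun j => ratSize (v j))
    (fun _ _ => Nat.zero_le _) (Finset.mem_univ j)
  simp only [vecSize]
  omega

theorem ratSize_le_matSize {ι κ : Type} [Fintype ι] [Fintype κ] (A : Matrix ι κ ℚ) (i : ι)
    (j : κ) : ratSize (A i j) ≤ matSize A := by
  have h1 := Finset.single_le_sum (f := fun j => ratSize (A i j))
    (fun _ _ => Nat.zero_le _) (Finset.mem_univ j)
  have h2 := Finset.single_le_sum (f := fun i => ∑ j, ratSize (A i j))
    (fun _ _ => Nat.zero_le _) (Finset.mem_univ i)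
  simp only [matSize]
  omega

theorem maxEntrySize_le_inputSize : P.maxEntrySize ≤ P.inputSize := by
  refine max_le ?_ (max_le ?_ ?_)
  · exact Finset.sup_le fun l _ => Finset.sup_le fun i _ => Finset.sup_le fun r _ =>
      Finset.sup_le fun j _ => (ratSize_le_matSize _ r j).trans (P.matSize_le_inputSize l i)
  · exact Finset.sup_le fun l _ => Finset.sup_le fun r _ =>
      (ratSize_le_vecSize _ r).trans (P.vecSize_b_le_inputSize l)
  · exact Finset.sup_le fun l _ => Finset.sup_le fun i hi => Finset.sup_le fun j _ =>
      (ratSize_le_vecSize _ j).trans (P.vecSize_c_le_inputSize (Finset.mem_Ici.mp hi))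

theorem numVars_le_inputSize : P.numVars ≤ P.inputSize := by
  have h : P.numVars ≤ ∑ l, ∑ i ∈ Finset.Ici l, vecSize (P.c l i) := by
    refine Finset.sum_le_sum fun l _ => ?_
    refine le_trans ?_ (Finset.single_le_sum (f := fun i => vecSize (P.c l i))
      (fun _ _ => Nat.zero_le _) (Finset.mem_Ici.mpr le_rfl))
    simp [vecSize]
  simp only [inputSize]
  omega

theorem saturated_linearConstraints (l : Fin k) :
    Saturated (2 ^ (expPoly 0).eval (P.numVars + P.maxEntrySize))
      {x | P.LinearConstraints l x} := by
  intro x x' hx h r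
  have hsat := saturated_halfspace P.maxEntrySize (fun v : P.Var => P.A l v.1 r v.2) (P.b l r)
    (fun v => Or.inr (P.ratSize_A_le _ _ _ _)) (Or.inr (P.ratSize_b_le _ _))
  have hle : 2 ^ (P.maxEntrySize * (Fintype.card P.Var + 2)) ≤
      2 ^ (expPoly 0).eval (P.numVars + P.maxEntrySize) := by
    rw [eval_expPoly_zero, card_var]
    exact Nat.pow_le_pow_right (by norm_num) (Nat.mul_le_mul (by omega) (by omega))
  have hr := h r
  have := hsat.mono hle hx (by simpa [Fintype.sum_sigma] using hr)
  simpa [Fintype.sum_sigma] using this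

/-- The objectives are, up to scaling, integer forms with small coefficients. -/
theorem exists_int_objective (l : Fin k) :
    ∃ (Δ : ℕ) (o : P.Var → ℤ), 0 < Δ ∧
      Δ ≤ 2 ^ (expPoly 0).eval (P.numVars + P.maxEntrySize) ∧
      (∀ v, |o v| ≤ (2 ^ (expPoly 0).eval (P.numVars + P.maxEntrySize) : ℕ)) ∧
      ∀ x, affForm o 0 x = Δ * P.objective l x := by
  obtain ⟨Δ, o, -, hΔ, hΔle, ho, -, hobd, -⟩ := exists_clear_denominators P.maxEntrySize
    -- Vectors `c l i` with `i < l` are not covered by `maxEntrySize`; zeros replace them, which are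
    -- exempt from the size hypothesis.
    (fun v : P.Var => if l ≤ v.1 then P.c l v.1 v.2 else 0) 0 (fun v => by
      by_cases h : l ≤ v.1
      · simp only [if_pos h]
        exact Or.inr (P.ratSize_c_le h _)
      · exact Or.inl (if_neg h)) (Or.inl rfl)
  have hle : 2 ^ (P.maxEntrySize * (Fintype.card P.Var + 2)) ≤
      2 ^ (expPoly 0).eval (P.numVars + P.maxEntrySize) := by
    rw [eval_expPoly_zero, card_var]
    exact Nat.pow_le_pow_right (by norm_num) (Nat.mul_le_mul (by omega) (by omega))
  refine ⟨Δ, o, hΔ, hΔle.trans hle, fun v => (hobd v).trans (by exact_mod_cast hle), fun x => ?_⟩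
  have hoR : ∀ v, (o v : ℝ) = Δ * ((if l ≤ v.1 then P.c l v.1 v.2 else 0 : ℚ) : ℝ) :=
    fun v => by exact_mod_cast congrArg (Rat.cast (K := ℝ)) (ho v)
  have hsum : P.objective l x =
      ∑ i, ∑ j, ((if l ≤ i then P.c l i j else 0 : ℚ) : ℝ) * x ⟨i, j⟩ := by
    rw [objective, ← Finset.filter_le_eq_Ici, Finset.sum_filter]
    refine Finset.sum_congr rfl fun i _ => ?_
    by_cases h : l ≤ i <;> simp [h]
  simp only [affForm, hoR, hsum, Fintype.sum_sigma, Finset.mul_sum, Int.cast_zero, add_zero,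
    mul_assoc]

/-- The given decisions enter only through agreement with `z`, so each player has one fixed set in
the full space, whose fibers are the feasible sets. -/
theorem mem_feasibleSet_iff (l : Fin k) (z x : P.Var → ℝ) :
    x ∈ P.feasibleSet l z ↔
      (∀ i < l, ∀ j, x ⟨i, j⟩ = z ⟨i, j⟩) ∧ x ∈ P.feasibleSet l x := by
  rw [feasibleSet.eq_1 P l z, feasibleSet.eq_1 P l x]
  simp

theorem mem_feasibleSet_self_iff (l : Fin k) (x : P.Var → ℝ) :
    x ∈ P.feasibleSet l x ↔ P.LinearConstraints l x ∧ ∀ h : (l : ℕ) + 1 < k,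
      x ∈ P.feasibleSet ⟨(l : ℕ) + 1, h⟩ x ∧ ∀ y ∈ {y | y ∈ P.feasibleSet ⟨(l : ℕ) + 1, h⟩ y},
        (∀ v : P.Var, v.1 < ⟨(l : ℕ) + 1, h⟩ → y v = x v) →
          P.objective ⟨(l : ℕ) + 1, h⟩ x ≤ P.objective ⟨(l : ℕ) + 1, h⟩ y := by
  rw [feasibleSet.eq_1 P l x]
  simp only [argmin, Set.mem_ofPred_eq, implies_true, true_and]
  refine and_congr_right fun _ => forall_congr' fun h => and_congr_right fun _ => ?_
  refine forall_congr' fun y => ?_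
  rw [mem_feasibleSet_iff P _ x y, and_imp, Sigma.forall]
  constructor
  · exact fun H h1 h2 => H (fun i hi j => h2 i j hi) h1
  · exact fun H h1 h2 => H h2 fun i j hi => h1 i hi j

theorem saturated_argmin {e : ℕ} {S : Set (P.Var → ℝ)} (l : Fin k) (J : P.Var → Prop)
    (hS : Saturated (2 ^ (expPoly e).eval (P.numVars + P.maxEntrySize)) S) :
    Saturated (2 ^ (expPoly (e + 1)).eval (P.numVars + P.maxEntrySize))
      {x | x ∈ S ∧ ∀ y ∈ S, (∀ v, J v → y v = x v) → P.objective l x ≤ P.objective l y} := by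
  obtain ⟨Δ, o, hΔ, -, ho, hobj⟩ := P.exists_int_objective l
  have hΔR : (0 : ℝ) < Δ := by exact_mod_cast hΔ
  have hle : 2 ^ (expPoly 0).eval (P.numVars + P.maxEntrySize) ≤
      2 ^ (expPoly e).eval (P.numVars + P.maxEntrySize) :=
    Nat.pow_le_pow_right (by norm_num) (eval_expPoly_mono _ (Nat.zero_le e))
  have h := (hS.argmin_fiber Nat.one_le_two_pow o
    (fun v => (ho v).trans (by exact_mod_cast hle)) J).mono
    (elimBound_expPoly_le (by rw [card_var]; exact Nat.le_add_right _ _) e)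
  simpa only [hobj, mul_le_mul_iff_right₀ hΔR] using h

/-- Backward induction, where `j` bounds the number of players after `l`; each of them costs one
elimination. -/
theorem saturated_feasibleSet_self (j : ℕ) : ∀ l : Fin k, k ≤ (l : ℕ) + 1 + j →
    Saturated (2 ^ (expPoly j).eval (P.numVars + P.maxEntrySize))
      {x | x ∈ P.feasibleSet l x} := by
  induction j with
  | zero =>
    intro l hl x x' hx h
    rw [Set.mem_ofPred_eq, mem_feasibleSet_self_iff] at h ⊢
    exact ⟨P.saturated_linearConstraints l hx h.1, fun h => absurd h (by omega)⟩
  | succ j ih =>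
    intro l hl x x' hx h
    rw [Set.mem_ofPred_eq, mem_feasibleSet_self_iff] at h ⊢
    have hle := Nat.pow_le_pow_right (n := 2) (by norm_num)
      (eval_expPoly_mono (P.numVars + P.maxEntrySize) (Nat.zero_le (j + 1)))
    refine ⟨(P.saturated_linearConstraints l).mono hle hx h.1, fun hk => ?_⟩
    exact P.saturated_argmin ⟨(l : ℕ) + 1, hk⟩ (fun v => v.1 < ⟨(l : ℕ) + 1, hk⟩)
      (ih ⟨(l : ℕ) + 1, hk⟩ (by simp only; omega)) hx (h.2 hk)

variable [NeZero k]

theorem saturated_feasible :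
    Saturated (2 ^ (expPoly k).eval (P.numVars + P.maxEntrySize)) P.feasible := by
  have h : P.feasible = {x | x ∈ P.feasibleSet 0 x} := by
    ext x
    rw [feasible, mem_feasibleSet_iff]
    simp
  rw [h]
  exact P.saturated_feasibleSet_self k 0 (by omega)

theorem saturated_optimal :
    Saturated (2 ^ (expPoly (k + 1)).eval (P.numVars + P.maxEntrySize)) P.optimal := by
  have h := P.saturated_argmin 0 (fun _ => False) P.saturated_feasible
  simpa [optimal, argmin] using h

theorem isGLB_of_optValue_eq {r : ℝ} (h : P.optValue = (r : EReal)) :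
    IsGLB (P.objective 0 '' P.feasible) r := by
  constructor
  · rintro _ ⟨x, hx, rfl⟩
    have : P.optValue ≤ ((P.objective 0 x : ℝ) : EReal) := iInf₂_le x hx
    rw [h] at this
    exact_mod_cast this
  · intro s hs
    have : (s : EReal) ≤ P.optValue :=
      le_iInf₂ fun x hx => by exact_mod_cast hs ⟨x, hx, rfl⟩
    rw [h] at this
    exact_mod_cast this

/-- The scaled value `Δ * r` is the infimum of a saturated set on the line, hence some `a / b`, and
`r = a / (b * Δ)`; the product in the denominator doubles the exponent. -/
theorem exists_rat_optValue {r : ℝ} (h : P.optValue = (r : EReal)) :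
    ∃ q : ℚ, (q : ℝ) = r ∧
      ratSize q ≤ 4 * (expPoly (k + 1)).eval (P.numVars + P.maxEntrySize) + 3 := by
  obtain ⟨Δ, o, hΔ, hΔle, ho, hobj⟩ := P.exists_int_objective 0
  have hΔR : (0 : ℝ) < Δ := by exact_mod_cast hΔ
  set s := P.numVars + P.maxEntrySize
  have hle : ∀ j, 2 ^ (expPoly 0).eval s ≤ 2 ^ (expPoly j).eval s := fun j =>
    Nat.pow_le_pow_right (by norm_num) (eval_expPoly_mono _ (Nat.zero_le _))
  have hV := (P.saturated_feasible.image_affForm Nat.one_le_two_pow o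
    (fun v => (ho v).trans (by exact_mod_cast hle k))).mono
    (elimBound_expPoly_le (by rw [card_var]; exact Nat.le_add_right _ _) k)
  have hglb := P.isGLB_of_optValue_eq h
  obtain ⟨a, b, hb, ha, hb', hab⟩ := hV.isGLB_eq_div (r := Δ * r) (by
    constructor
    · rintro t ⟨x, hx, ht⟩
      change affForm o 0 x = t at ht
      have := hglb.1 ⟨x, hx, rfl⟩
      rw [← ht, hobj]
      exact mul_le_mul_of_nonneg_left this hΔR.le
    · intro t ht
      rw [← div_le_iff₀' hΔR]
      refine hglb.2 ?_
      rintro _ ⟨x, hx, rfl⟩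
      rw [div_le_iff₀' hΔR, ← hobj]
      exact ht ⟨x, hx, rfl⟩)
  have hbR : (0 : ℝ) < b := by exact_mod_cast hb
  refine ⟨a / ((b * Δ : ℤ) : ℚ), ?_, ?_⟩
  · push_cast
    rw [div_eq_iff (by positivity)]
    rw [eq_div_iff hbR.ne'] at hab
    linarith
  · have hpow : 2 ^ (2 * (expPoly (k + 1)).eval s) =
        2 ^ (expPoly (k + 1)).eval s * 2 ^ (expPoly (k + 1)).eval s := by
      rw [← pow_add]; congr 1; ring
    have := ratSize_div_le (a := a) (b := b * Δ) (t := 2 * (expPoly (k + 1)).eval s)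
      (by positivity) (ha.trans (by
        rw [hpow]; exact_mod_cast Nat.le_mul_of_pos_left _ (by positivity))) (by
        rw [hpow, Nat.cast_mul]
        exact mul_le_mul hb' (by exact_mod_cast hΔle.trans (hle _)) (by positivity)
          (by positivity))
    omega

end Instance

end MultilevelLP

/-! ### A single polynomial for all four bounds. -/

theorem mainTheorem2 (k : ℕ) [NeZero k] :
    ∃ p : Polynomial ℕ, ∀ P : MultilevelLP.Instance k,
      (∃ (N : ℕ) (Q : Fin N → Set (P.Var → ℝ)),
        (∀ t, MultilevelLP.IsRatGenPolyhedron (p.eval (P.numVars + P.maxEntrySize)) (Q t)) ∧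
          P.feasible = ⋃ t, Q t) ∧
      (P.feasible.Nonempty →
        ∃ q : P.Var → ℚ, (fun v => (q v : ℝ)) ∈ P.feasible ∧
          MultilevelLP.vecSize q ≤ p.eval P.inputSize) ∧
      (P.optimal.Nonempty →
        ∃ q : P.Var → ℚ, (fun v => (q v : ℝ)) ∈ P.optimal ∧
          MultilevelLP.vecSize q ≤ p.eval P.inputSize) ∧
      (P.optValue ≠ ⊤ → P.optValue ≠ ⊥ →
        ∃ q : ℚ, P.optValue = ((q : ℝ) : EReal) ∧
          MultilevelLP.ratSize q ≤ p.eval P.inputSize) := by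
  open MultilevelLP in
  -- Optimality costs one elimination beyond level `k` and extracting a rational point another,
  -- hence `k + 2`. The factor `X + 1` pays for the number of coordinates.
  let p₀ : Polynomial ℕ := (Polynomial.X + 1) * (4 * expPoly (k + 2) + 8)
  -- Bounding `n` and `σ` by `L` separately gives `n + σ ≤ 2 L`, whence the argument `2 X`.
  refine ⟨p₀.comp (2 * Polynomial.X), fun P => ?_⟩
  set s := P.numVars + P.maxEntrySize with hs
  have hp₀ : ∀ t, p₀.eval t = (t + 1) * (4 * (expPoly (k + 2)).eval t + 8) := fun t => by
    simp [p₀]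
  have hp : ∀ t, (p₀.comp (2 * Polynomial.X)).eval t = p₀.eval (2 * t) := fun t => by simp
  have hmono := eval_natPoly_mono p₀
  have hps : p₀.eval s ≤ (p₀.comp (2 * Polynomial.X)).eval s := by
    rw [hp]; exact hmono (by omega)
  have hpL : p₀.eval s ≤ (p₀.comp (2 * Polynomial.X)).eval P.inputSize := by
    rw [hp]
    exact hmono (by
      have h1 := P.numVars_le_inputSize
      have h2 := P.maxEntrySize_le_inputSize
      omega)
  have hE₁ : (expPoly k).eval s ≤ (expPoly (k + 2)).eval s := eval_expPoly_mono s (by omega)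
  have hE₂ : (expPoly (k + 1)).eval s ≤ (expPoly (k + 2)).eval s := eval_expPoly_mono s (by omega)
  have hbase : 4 * (expPoly (k + 2)).eval s + 8 ≤ p₀.eval s := by
    rw [hp₀]; exact Nat.le_mul_of_pos_left _ (Nat.succ_pos s)
  have hcard : Fintype.card P.Var ≤ s := by rw [P.card_var]; omega
  have hvec : ∀ e, (expPoly e).eval s ≤ (expPoly (k + 2)).eval s →
      Fintype.card P.Var + Fintype.card P.Var * (4 * (expPoly e).eval s + 7) ≤ p₀.eval s := by
    intro e he
    rw [hp₀]
    calc _ = Fintype.card P.Var * (4 * (expPoly e).eval s + 8) := by ring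
      _ ≤ _ := Nat.mul_le_mul (by omega) (by omega)
  refine ⟨?_, fun hne => ?_, fun hne => ?_, fun htop hbot => ?_⟩
  · obtain ⟨N, Q, hQ, hU⟩ := P.saturated_feasible.exists_iUnion
    refine ⟨N, Q, fun t => ?_, hU⟩
    obtain ⟨m, m', A, a, B, b, hA, ha, hB, hb, h⟩ := hQ t
    have hle : 2 * (expPoly k).eval s + 3 ≤ (p₀.comp (2 * Polynomial.X)).eval s := by omega
    exact ⟨m, m', A, a, B, b, fun r j => (hA r j).trans hle, fun r => (ha r).trans hle,
      fun r j => (hB r j).trans hle, fun r => (hb r).trans hle, h⟩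
  · obtain ⟨q, hq, hsize⟩ := P.saturated_feasible.exists_rat hne (elimBound_expPoly_le hcard k)
    exact ⟨q, hq, hsize.trans ((hvec _ hE₂).trans hpL)⟩
  · obtain ⟨q, hq, hsize⟩ := P.saturated_optimal.exists_rat hne
      (elimBound_expPoly_le hcard (k + 1))
    exact ⟨q, hq, hsize.trans ((hvec _ le_rfl).trans hpL)⟩
  · obtain ⟨q, hq, hsize⟩ := P.exists_rat_optValue (EReal.coe_toReal htop hbot).symm
    rw [← hs] at hsize
    refine ⟨q, ?_, hsize.trans (by omega)⟩
    rw [hq, EReal.coe_toReal htop hbot]
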